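/- **Notation.** For $1\le p\le\infty$, $L_p$ is the space of $2\pi$-periodic functions with $\|f\|_p=\big(\int_0^{2\pi}|f(t)|^p\,dt\big)^{1/p}<\infty$ (essential supremum for $p=\infty$), and $\hat f(k)=\frac1{2\pi}\int_{-\pi}^{\pi}f(t)e^{-ikt}\,dt$. For a sequence $\psi(k)>0$, $k\in\mathbb N$, and $\beta\in\mathbb R$, $L^{\psi}_{\beta,1}$ is the class of real-valued $f\in L_1$ for which there is a real-valued $\varphi\in L_1$ with $\|\varphi\|_1\le 1$ whose Fourier series is $\sum_{k\in\mathbb Z\setminus\{0\}}\frac{\hat f(k)}{\psi(|k|)}e^{i(kx+\frac{\beta\pi}{2}\operatorname{sign}k)}$. For $m\in\mathbb N$, $$e^{\bot}_m(L^\psi_{\beta,1})_s=\sup_{f\in L^\psi_{\beta,1}}\ \inf_{\gamma_m}\Big\|f(x)-\sum_{k\in\gamma_m}\hat f(k)e^{ikx}\Big\|_s ,$$ where $\gamma_m$ runs over all sets of $m$ integers. Let $\mathfrak M$ be the set of positive, continuous, convex functions $\psi$ on $[1,\infty)$ with $\lim_{t\to\infty}\psi(t)=0$; put $\alpha(\psi;t)=\frac{\psi(t)}{t|\psi'(t+0)|}$,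 $\underline\alpha_1(\psi)=\inf_{t\ge1}\alpha(\psi;t)$, and let $\mathfrak M_0$ be the set of $\psi\in\mathfrak M$ for which there is $K>0$ with $\alpha(\psi;t)\ge K$ for all $t\ge 1$. Put $g_p(t)=\psi(t)t^{1/p}$, and for $1<p<\infty$, $\frac1p+\frac1{p'}=1$, $$\xi(p)=\max\Big\{4\Big(\frac{\pi}{p-1}\Big)^{1/p},\ 14(8\pi)^{1/p}p\Big\},$$ $$K^{(1)}_{\psi,p}=\frac1{3\xi(p)}\Big(\frac{\underline\alpha_1(g_p)}{p'+\underline\alpha_1(g_p)}\Big)^{1/p}\Big(1-\frac{p'}{\underline\alpha_1(g_p)}\Big),\qquad K^{(2)}_{\psi,p}=\frac1\pi\,\xi(p')\Big(\frac{p'+\underline\alpha_1(g_p)}{\underline\alpha_1(g_p)}\Big)^{1/p'} .$$ **Theorem.** Let $1<s<\infty$, $\frac1s+\frac1{s'}=1$, let $\psi\in\mathfrak M$ (restricted to $\mathbb N$, $\psi$ gives the sequence $\psi(k)$), and suppose that $\sum_{k=1}^\infty\psi^s(k)k^{s-2}<\infty$, $g_{s'}\in\mathfrak M_0$ and $\underline\alpha_1(g_{s'})>s$.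 Then for all $n\in\mathbb N=\{1,2,\dots\}$ and $\beta\in\mathbb R$ $$\frac43K^{(1)}_{\psi,s'}\Big(\sum_{k=n}^\infty\psi^s(k)k^{s-2}\Big)^{1/s}\le e^{\bot}_{2n}(L^\psi_{\beta,1})_s\le e^{\bot}_{2n-1}(L^\psi_{\beta,1})_s\le K^{(2)}_{\psi,s'}\Big(\sum_{k=n}^\infty\psi^s(k)k^{s-2}\Big)^{1/s}.$$ -/

import Mathlib

open Set Filter Topology MeasureTheory
open scoped ENNReal Real

namespace OrthTrig

noncomputable section

/-- Lebesgue measure on one period `[0, 2π)`. -/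
def periodMeasure : Measure ℝ := volume.restrict (Ico 0 (2 * π))

/-- The norm `‖f‖_p = (∫_0^{2π} |f|^p)^{1/p}` (essential supremum for `p = ∞`),
as an element of `[0, ∞]`. -/
def pnorm {E : Type*} [NormedAddCommGroup E] (f : ℝ → E) (p : ℝ≥0∞) : ℝ≥0∞ :=
  eLpNorm f p periodMeasure

/-- `f` is a `2π`-periodic function belonging to `L_p`. -/
def MemL {E : Type*} [NormedAddCommGroup E] (f : ℝ → E) (p : ℝ≥0∞) : Prop :=
  Function.Periodic f (2 * π) ∧ MemLp f p periodMeasure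

theorem neg_pi_lt_pi : -π < π := by linarith [Real.pi_pos]

/-- The Fourier coefficient `(1/2π) ∫_{-π}^{π} f(t) e^{-ikt} dt` of a real function `f`. -/
def coef (f : ℝ → ℝ) (k : ℤ) : ℂ :=
  fourierCoeffOn neg_pi_lt_pi (fun t => (f t : ℂ)) k

/-- `fourierCoeffOn` on `[-π, π]` is the usual integral. -/
theorem coef_eq (f : ℝ → ℝ) (k : ℤ) :
    coef f k = (1 / (2 * π) : ℂ) *
      ∫ t in (-π)..π, (f t : ℂ) * Complex.exp (-(Complex.I * k * t)) := by
  have hπ : (π : ℂ) ≠ 0 := by exact_mod_cast Real.pi_ne_zero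
  rw [coef, fourierCoeffOn_eq_integral, Complex.real_smul]
  congr 1
  · push_cast
    ring
  · refine intervalIntegral.integral_congr fun t _ => ?_
    simp only [fourier_coe_apply, smul_eq_mul]
    rw [mul_comm]
    congr 2
    push_cast
    field_simp
    ring

/-- `φ` is a `(ψ, β)`-derivative of `f`: a `2π`-periodic summable function whose Fourier series is
`∑_{k ≠ 0} (f̂(k) / ψ(|k|)) e^{i (k x + (β π / 2) sign k)}`. -/
def IsPsiBetaDeriv (ψ : ℕ → ℝ) (β : ℝ) (f φ : ℝ → ℝ) : Prop :=
  MemL φ 1 ∧ coef φ 0 = 0 ∧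
    ∀ k : ℤ, k ≠ 0 →
      coef φ k = coef f k / (ψ k.natAbs : ℂ) *
        Complex.exp (Complex.I * ((β * π / 2 * (k.sign : ℝ) : ℝ) : ℂ))

/-- The class `L^ψ_{β,p}`: real `2π`-periodic summable functions possessing a `(ψ, β)`-derivative
in the unit ball of the real space `L_p`. -/
def LClass (ψ : ℕ → ℝ) (β : ℝ) (p : ℝ≥0∞) : Set (ℝ → ℝ) :=
  {f | MemL f 1 ∧ ∃ φ : ℝ → ℝ, IsPsiBetaDeriv ψ β f φ ∧ MemL φ p ∧ pnorm φ p ≤ 1}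

/-- The partial Fourier sum `S_γ(f; x) = ∑_{k ∈ γ} f̂(k) e^{ikx}`. -/
def partialSum (γ : Finset ℤ) (f : ℝ → ℝ) (x : ℝ) : ℂ :=
  ∑ k ∈ γ, coef f k * Complex.exp (Complex.I * k * x)

/-- Best orthogonal trigonometric approximation `e^⊥_m(f)_s` of a function: the infimum of
`‖f - S_γ(f)‖_s` over all sets `γ` of `m` integers. -/
def bestOrth (m : ℕ) (f : ℝ → ℝ) (s : ℝ≥0∞) : ℝ≥0∞ :=
  ⨅ γ : {γ : Finset ℤ // γ.card = m}, pnorm (fun x => (f x : ℂ) - partialSum γ.1 f x) s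

/-- Best orthogonal trigonometric approximation `e^⊥_m(F)_s` of a class of functions. -/
def bestOrthClass (m : ℕ) (F : Set (ℝ → ℝ)) (s : ℝ≥0∞) : ℝ≥0∞ :=
  ⨆ f ∈ F, bestOrth m f s

/-- The set `𝔐` of positive, continuous, convex functions on `[1, ∞)` tending to `0` at infinity
(values outside `[1, ∞)` are irrelevant). -/
def frakM : Set (ℝ → ℝ) :=
  {ψ | (∀ t, 1 ≤ t → 0 < ψ t) ∧ ContinuousOn ψ (Ici 1) ∧ ConvexOn ℝ (Ici 1) ψ ∧
    Tendsto ψ atTop (𝓝 0)}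

/-- `α(ψ; t) = ψ(t) / (t |ψ'(t + 0)|)`, with the right derivative. -/
def alpha (ψ : ℝ → ℝ) (t : ℝ) : ℝ :=
  ψ t / (t * |derivWithin ψ (Ioi t) t|)

/-- The subset `𝔐₀` of `𝔐`: `α(ψ; ·)` is bounded below on `[1, ∞)` by a positive constant. -/
def frakM₀ : Set (ℝ → ℝ) :=
  {ψ | ψ ∈ frakM ∧ ∃ K : ℝ, 0 < K ∧ ∀ t, 1 ≤ t → K ≤ alpha ψ t}

/-- `inf_{t ≥ n} α(ψ; t)`. -/
def alphaInf (ψ : ℝ → ℝ) (n : ℕ) : ℝ :=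
  ⨅ t : Ici (n : ℝ), alpha ψ t

/-- `g_p(t) = ψ(t) t^{1/p}`. -/
def gFun (ψ : ℝ → ℝ) (p : ℝ) (t : ℝ) : ℝ := ψ t * t ^ (1 / p)

/-- `ξ(s) = max {4 (π/(s-1))^{1/s}, 14 (8π)^{1/s} s}`. -/
def xi (s : ℝ) : ℝ :=
  max (4 * (π / (s - 1)) ^ (1 / s)) (14 * (8 * π) ^ (1 / s) * s)

/-- `K^{(1)}_{ψ,p}`, with `p' = p / (p - 1)` the conjugate exponent. -/
def K₁ (ψ : ℝ → ℝ) (p : ℝ) : ℝ :=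
  let p' := Real.conjExponent p
  let a := alphaInf (gFun ψ p) 1
  1 / (3 * xi p) * (a / (p' + a)) ^ (1 / p) * (1 - p' / a)

/-- `K^{(2)}_{ψ,p}`, with `p' = p / (p - 1)` the conjugate exponent. -/
def K₂ (ψ : ℝ → ℝ) (p : ℝ) : ℝ :=
  let p' := Real.conjExponent p
  let a := alphaInf (gFun ψ p) 1
  1 / π * xi p' * ((p' + a) / a) ^ (1 / p')

/-- The tail `∑_{k=n}^∞ ψ(k)^s k^{s-2}`. -/
def tailSum (ψ : ℝ → ℝ) (s : ℝ) (n : ℕ) : ℝ :=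
  ∑' j : ℕ, ψ ((n + j : ℕ) : ℝ) ^ s * ((n + j : ℕ) : ℝ) ^ (s - 2)

end

end OrthTrig

/-!
The kernel behind the class is `∑ ψ(k) cos (k t - β π / 2)`: a function `f` with `(ψ, β)`-derivative
`φ` is, up to its mean value, the convolution of `φ` with this kernel divided by `π`. Put
`g(t) = ψ(t) t ^ (1 / s')`, `a = inf α(g; ·)` and `q = s / a < 1`. The terms of the tail sum are
`ψ(k) ^ s k ^ (s - 2) = g(k) ^ s / k`, and the tail sum from `n` on is written `T n`.

*A Hardy–Littlewood bound.* If `c` is nonnegative and decreasing from `n` on, then on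
`(π / (N + 1), π / N]` the sum `∑_{n ≤ k < M} c_k e^{ikx}` is at most
`∑_{k ≤ N} c_k + (N + 1) c_N` for `N ≥ n` and at most `(N + 1) c_n` for `N < n`, by Abel summation.
Integrating the `r`-th power piece by piece and applying Hardy's inequality (`hardy_sum_le`) bounds
the `L_r` norm by `ξ(r) (B + ∑ c_k ^ r k ^ (r - 2)) ^ (1 / r)` with `B ≥ c_n ^ r n ^ (r - 1)`
(`pnorm_cosPoly_le`). Only trigonometric polynomials are involved.

*Growth of `g`.* The function `g` decreases, while `g(t) t ^ (1 / a)` increases, since its right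
derivative is nonnegative. Hence `g(n) ^ s ≤ q T n` (`rpow_le_mul_gTail`), which controls `B`, and
`(1 - q) T n ≤ T (2n)` (`one_sub_mul_gTail_le`).

*Upper bound.* The spectrum `|k| < n` has `2n - 1` elements. Young's inequality and the
Hardy–Littlewood bound with `c = ψ`, `r = s` show that the symmetric partial sums of `f` are Cauchy
in `L_s`. Their limit has the Fourier coefficients of `f`, hence equals `f` almost everywhere, and
the rate of convergence is the stated bound (`pnorm_sub_partialSum_le`).

*Middle inequality.* A harmonic with arbitrarily small coefficient can be added to any spectrum.

*Lower bound.* Take `φ = (F_N - 1) / (4π)` with the Fejér kernel `F_N`, which has mean value zero and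
`L₁` norm at most one, and let `f` be the function with this derivative. For a spectrum `γ` of `2n`
harmonics the error is paired with the test polynomial with coefficients
`b_k = ψ(k) ^ (s - 1) k ^ (s - 2)`, `n ≤ k < M`, and the same phase. The result is `1 / 4` of the sum
over `k ∉ γ` of a weight in `|k|` which is close to `ψ b` and decreasing, so that it is smallest when
`γ = {n ≤ |k| < 2n}` (`sum_natAbs_le`). Hölder's inequality, the Hardy–Littlewood bound with `c = b`,
`r = s'`, and the limits `N → ∞`, `M → ∞` give at least
`T (2n) / 2` divided by `ξ(s') ((1 + q) T n) ^ (1 / s')`.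
-/

namespace OrthTrig

/-! ### Hardy's inequality for finite sums -/

/-- Young's inequality for `y` and `z ^ (r - 1)`, with the exponents `r` and `r / (r - 1)`. -/
theorem young_rpow {y z r : ℝ} (hy : 0 ≤ y) (hz : 0 ≤ z) (hr : 1 < r) :
    r * (y * z ^ (r - 1)) ≤ y ^ r + (r - 1) * z ^ r := by
  have h := Real.young_inequality_of_nonneg hy (Real.rpow_nonneg hz (r - 1))
    (Real.HolderConjugate.conjExponent hr)
  have hz' : (z ^ (r - 1)) ^ (Real.conjExponent r) = z ^ r := by
    rw [← Real.rpow_mul hz, Real.conjExponent]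
    congr 1
    field_simp [(sub_pos.2 hr).ne']
  rw [hz'] at h
  have hr0 : 0 < r := by linarith
  have hr1 : 0 < r - 1 := by linarith
  calc r * (y * z ^ (r - 1)) ≤ r * (y ^ r / r + z ^ r / Real.conjExponent r) := by gcongr
    _ = y ^ r + (r - 1) * z ^ r := by
      rw [Real.conjExponent]
      field_simp

/-- Hardy's inequality `∑ N⁻² A_N ^ r ≲ ∑ N ^ (r - 2) a_N ^ r` for the partial sums `A_N`, on a
finite range. The weight `1 / (N (N + 1))` telescopes, and Young's inequality absorbs part of the
resulting sum into the left-hand side. -/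
theorem hardy_sum_le {r : ℝ} (hr : 1 < r) {n : ℕ} (hn : 1 ≤ n) {a : ℕ → ℝ}
    (ha : ∀ k, n ≤ k → 0 ≤ a k) (K : ℕ) :
    ∑ N ∈ Finset.Ico n K, (∑ k ∈ Finset.Ico n (N + 1), a k) ^ r / ((N : ℝ) * (N + 1)) ≤
      (2 * r) ^ r / 2 * ∑ N ∈ Finset.Ico n K, a N ^ r * (N : ℝ) ^ (r - 2) := by
  have hr0 : 0 < r := by linarith
  set A : ℕ → ℝ := fun N => ∑ k ∈ Finset.Ico n N, a k with hA
  have hA0 : ∀ N, 0 ≤ A N := fun N =>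
    Finset.sum_nonneg fun k hk => ha k (Finset.mem_Ico.1 hk).1
  have hAs : ∀ N, n ≤ N → A (N + 1) = A N + a N := fun N hN => Finset.sum_Ico_succ_top hN a
  have step : ∀ K, n ≤ K →
      ∑ N ∈ Finset.Ico n K, A (N + 1) ^ r / ((N : ℝ) * (N + 1)) + A K ^ r / K ≤
        ∑ N ∈ Finset.Ico n K, r * (a N * A (N + 1) ^ (r - 1)) / N := by
    intro K hK
    induction K, hK using Nat.le_induction with
    | base => simp [hA, Real.zero_rpow hr0.ne']
    | succ K hK ih =>
      rw [Finset.sum_Ico_succ_top hK, Finset.sum_Ico_succ_top hK]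
      have hK0 : (0 : ℝ) < K := by exact_mod_cast (lt_of_lt_of_le hn hK)
      have hy := young_rpow (hA0 K) (hA0 (K + 1)) hr
      have hpow : A (K + 1) * A (K + 1) ^ (r - 1) = A (K + 1) ^ r := by
        rcases (hA0 (K + 1)).eq_or_lt with h0 | h0
        · rw [← h0, zero_mul, Real.zero_rpow hr0.ne']
        · rw [← Real.rpow_one_add' (hA0 _) (by linarith)]
          congr 1
          ring
      have hle : A (K + 1) ^ r - A K ^ r ≤ r * (a K * A (K + 1) ^ (r - 1)) := by
        have : a K = A (K + 1) - A K := by rw [hAs K hK]; ring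
        rw [this, sub_mul, hpow]
        linarith
      have hdiv : A (K + 1) ^ r / K - A K ^ r / K ≤ r * (a K * A (K + 1) ^ (r - 1)) / K := by
        rw [← sub_div]
        gcongr
      have htel : A (K + 1) ^ r / ((K : ℝ) * (K + 1)) + A (K + 1) ^ r / ((K + 1 : ℕ) : ℝ) =
          A (K + 1) ^ r / K := by
        push_cast
        field_simp
        ring
      linarith
  rcases lt_or_ge K n with hK | hK
  · simp [Finset.Ico_eq_empty_of_le hK.le]
  have hmain := step K hK
  have hb : ∑ N ∈ Finset.Ico n K, r * (a N * A (N + 1) ^ (r - 1)) / N ≤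
      ∑ N ∈ Finset.Ico n K, ((2 * r) ^ r / (2 * r) * (a N ^ r * (N : ℝ) ^ (r - 2)) +
        (r - 1) / r * (A (N + 1) ^ r / ((N : ℝ) * (N + 1)))) := by
    refine Finset.sum_le_sum fun N hN => ?_
    obtain ⟨hnN, -⟩ := Finset.mem_Ico.1 hN
    have hN1 : (1 : ℝ) ≤ N := by exact_mod_cast hn.trans hnN
    have hN0 : (0 : ℝ) < N := by linarith
    have haN := ha N hnN
    have hy := young_rpow (y := 2 * r * (a N * N)) (by positivity) (hA0 (N + 1)) hr
    rw [Real.mul_rpow (by positivity) (by positivity), Real.mul_rpow haN hN0.le] at hy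
    have hN2 : (N : ℝ) ^ r = (N : ℝ) ^ (r - 2) * N ^ 2 := by
      rw [← Real.rpow_natCast (N : ℝ) 2, ← Real.rpow_add hN0]
      congr 1
      push_cast
      ring
    rw [hN2] at hy
    set Z := A (N + 1) ^ (r - 1)
    set W := A (N + 1) ^ r
    have hW : 0 ≤ W := Real.rpow_nonneg (hA0 _) _
    set C := (2 * r) ^ r
    set X := a N ^ r
    set Y := (N : ℝ) ^ (r - 2)
    have h1 : r * (a N * Z) / N ≤ (C * (X * (Y * N ^ 2)) + (r - 1) * W) / (2 * r * N ^ 2) := by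
      rw [div_le_div_iff₀ hN0 (by positivity)]
      nlinarith [mul_le_mul_of_nonneg_left hy hN0.le]
    have h2 : W / (2 * N ^ 2) ≤ W / ((N : ℝ) * (N + 1)) := by
      apply div_le_div_of_nonneg_left hW (by positivity)
      nlinarith
    have h3 : (C * (X * (Y * N ^ 2)) + (r - 1) * W) / (2 * r * N ^ 2) =
        C / (2 * r) * (X * Y) + (r - 1) / r * (W / (2 * N ^ 2)) := by
      field_simp
    rw [h3] at h1
    have h4 : 0 ≤ (r - 1) / r := div_nonneg (by linarith) hr0.le
    linarith [mul_le_mul_of_nonneg_left h2 h4]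
  rw [Finset.sum_add_distrib, ← Finset.mul_sum, ← Finset.mul_sum] at hb
  set S := ∑ N ∈ Finset.Ico n K, A (N + 1) ^ r / ((N : ℝ) * (N + 1))
  set T := ∑ N ∈ Finset.Ico n K, a N ^ r * (N : ℝ) ^ (r - 2)
  have hK' : 0 ≤ A K ^ r / K := div_nonneg (Real.rpow_nonneg (hA0 _) _) (Nat.cast_nonneg _)
  have hS : S / r ≤ (2 * r) ^ r / (2 * r) * T := by
    have : S / r = S - (r - 1) / r * S := by
      field_simp
      ring
    linarith
  calc S = r * (S / r) := by field_simp
    _ ≤ r * ((2 * r) ^ r / (2 * r) * T) := by gcongr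
    _ = (2 * r) ^ r / 2 * T := by field_simp

/-- `∑_{j ≤ n} j ^ (r - 2)` is at most `n ^ (r - 1) / min 1 (r - 1)`: each term is dominated by an
increment of `j ^ (r - 1)`. -/
theorem sum_rpow_sub_two_le {r : ℝ} (hr : 1 < r) (n : ℕ) :
    min 1 (r - 1) * ∑ j ∈ Finset.range n, ((j : ℝ) + 1) ^ (r - 2) ≤ (n : ℝ) ^ (r - 1) := by
  have hr1 : 0 < r - 1 := by linarith
  induction n with
  | zero => simp [Real.zero_rpow hr1.ne']
  | succ n ih =>
    rw [Finset.sum_range_succ, mul_add]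
    have hn1 : (0 : ℝ) < (n : ℝ) + 1 := by positivity
    set m : ℝ := (n : ℝ) + 1 with hm
    have hpow : m ^ (r - 1) = m ^ (r - 2) * m := by
      rw [← Real.rpow_add_one hn1.ne']
      congr 1
      ring
    have hP : 0 < m ^ (r - 2) := Real.rpow_pos_of_pos hn1 _
    have key : (n : ℝ) ^ (r - 1) + min 1 (r - 1) * m ^ (r - 2) ≤ m ^ (r - 1) := by
      have hfac : (n : ℝ) ^ (r - 1) = m ^ (r - 2) * m * (1 + -(1 / m)) ^ (r - 1) := by
        rw [← hpow, ← Real.mul_rpow hn1.le]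
        · congr 1
          rw [hm]
          field_simp
          ring
        · rw [hm]
          have : 1 / ((n : ℝ) + 1) ≤ 1 := by
            rw [div_le_one (by positivity)]
            linarith [Nat.cast_nonneg (α := ℝ) n]
          linarith
      have h1m : 1 / m ≤ 1 := by
        rw [div_le_one (by positivity)]
        linarith [Nat.cast_nonneg (α := ℝ) n]
      have h1m0 : 0 < 1 / m := by positivity
      have hb : (1 + -(1 / m)) ^ (r - 1) ≤ 1 - min 1 (r - 1) * (1 / m) := by
        rcases le_total (r - 1) 1 with h | h
        · rw [min_eq_right h]
          have := rpow_one_add_le_one_add_mul_self (s := -(1 / m)) (by linarith) hr1.le h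
          linarith
        · rw [min_eq_left h]
          calc (1 + -(1 / m)) ^ (r - 1) ≤ (1 + -(1 / m)) ^ (1 : ℝ) :=
                Real.rpow_le_rpow_of_exponent_ge' (by linarith) (by linarith) zero_le_one h
            _ = 1 - 1 * (1 / m) := by rw [Real.rpow_one]; ring
      rw [hfac, hpow]
      calc m ^ (r - 2) * m * (1 + -(1 / m)) ^ (r - 1) + min 1 (r - 1) * m ^ (r - 2)
          ≤ m ^ (r - 2) * m * (1 - min 1 (r - 1) * (1 / m)) + min 1 (r - 1) * m ^ (r - 2) := by
            gcongr
        _ = m ^ (r - 2) * m := by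
            field_simp
            ring
    push_cast
    linarith

/-! ### The `L_r` norm of a cosine polynomial with monotone coefficients -/

/-- Abel summation: a sum `∑ c_k z ^ k` with `|z| = 1` and nonnegative decreasing coefficients is at
most `2 c_p / |1 - z|`. -/
theorem norm_one_sub_mul_sum_le {c : ℕ → ℝ} {p : ℕ} (hc0 : ∀ k, p ≤ k → 0 ≤ c k)
    (hc : AntitoneOn c (Ici p)) {z : ℂ} (hz : ‖z‖ = 1) (m : ℕ) :
    ‖(1 - z) * ∑ k ∈ Finset.Ico p m, (c k : ℂ) * z ^ k‖ ≤ 2 * c p := by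
  have hzp : ∀ k, ‖z ^ k‖ = 1 := fun k => by rw [norm_pow, hz, one_pow]
  have step : ∀ m, p ≤ m →
      ‖(1 - z) * ∑ k ∈ Finset.Ico p (m + 1), (c k : ℂ) * z ^ k + c m * z ^ (m + 1)‖ ≤
        2 * c p - c m := by
    intro m hm
    induction m, hm using Nat.le_induction with
    | base =>
      have : (1 - z) * ∑ k ∈ Finset.Ico p (p + 1), (c k : ℂ) * z ^ k + c p * z ^ (p + 1) =
          c p * z ^ p := by
        simp only [Nat.Ico_succ_singleton, Finset.sum_singleton]
        ring
      rw [this, norm_mul, hzp, Complex.norm_real, Real.norm_of_nonneg (hc0 p le_rfl)]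
      linarith
    | succ m hm ih =>
      rw [Finset.sum_Ico_succ_top (by omega)]
      have h1 : c (m + 1) ≤ c m := hc hm (mem_Ici.2 (by omega)) (by omega)
      have : (1 - z) * (∑ k ∈ Finset.Ico p (m + 1), (c k : ℂ) * z ^ k +
            (c (m + 1) : ℂ) * z ^ (m + 1)) + c (m + 1) * z ^ (m + 1 + 1) =
          ((1 - z) * ∑ k ∈ Finset.Ico p (m + 1), (c k : ℂ) * z ^ k + c m * z ^ (m + 1)) +
            ((c (m + 1) - c m : ℝ) : ℂ) * z ^ (m + 1) := by
        push_cast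
        ring
      rw [this]
      refine (norm_add_le _ _).trans ?_
      rw [norm_mul, hzp, Complex.norm_real, Real.norm_of_nonpos (by linarith)]
      linarith
  rcases le_or_gt m p with hmp | hmp
  · simp [Finset.Ico_eq_empty_of_le hmp, hc0 p le_rfl]
  obtain ⟨m, rfl⟩ : ∃ m', m = m' + 1 := ⟨m - 1, by omega⟩
  have h := step m (by omega)
  have h2 : ‖(c m : ℂ) * z ^ (m + 1)‖ = c m := by
    rw [norm_mul, hzp, Complex.norm_real, Real.norm_of_nonneg (hc0 m (by omega)), mul_one]
  have := norm_sub_le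
    ((1 - z) * ∑ k ∈ Finset.Ico p (m + 1), (c k : ℂ) * z ^ k + c m * z ^ (m + 1))
    ((c m : ℂ) * z ^ (m + 1))
  rw [add_sub_cancel_right, h2] at this
  linarith

/-- The one-sided exponential sum `∑_{n ≤ k < M} c_k e^{ikx}`. -/
noncomputable def expSum (n M : ℕ) (c : ℕ → ℝ) (x : ℝ) : ℂ :=
  ∑ k ∈ Finset.Ico n M, (c k : ℂ) * Complex.exp (Complex.I * k * x)

theorem continuous_expSum (n M : ℕ) (c : ℕ → ℝ) : Continuous (expSum n M c) := by
  unfold expSum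
  fun_prop

theorem norm_expSum_two_pi_sub (n M : ℕ) (c : ℕ → ℝ) (x : ℝ) :
    ‖expSum n M c (2 * π - x)‖ = ‖expSum n M c x‖ := by
  rw [← Complex.norm_conj (expSum n M c x)]
  congr 1
  simp only [expSum, map_sum, map_mul, Complex.conj_ofReal, ← Complex.exp_conj, Complex.conj_I,
    Complex.conj_natCast]
  refine Finset.sum_congr rfl fun k _ => ?_
  congr 1
  rw [show Complex.I * k * ((2 * π - x : ℝ) : ℂ) =
    -Complex.I * k * x + k * (2 * π * Complex.I) by push_cast; ring, Complex.exp_add,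
    Complex.exp_nat_mul_two_pi_mul_I, mul_one]

theorem norm_expSum_le_sum {n : ℕ} {c : ℕ → ℝ} (hc0 : ∀ k, n ≤ k → 0 ≤ c k) (M : ℕ) (x : ℝ) :
    ‖expSum n M c x‖ ≤ ∑ k ∈ Finset.Ico n M, c k := by
  refine (norm_sum_le _ _).trans (Finset.sum_le_sum fun k hk => ?_)
  rw [norm_mul, Complex.norm_real, Real.norm_of_nonneg (hc0 k (Finset.mem_Ico.1 hk).1),
    show Complex.I * k * x = ((k * x : ℝ) : ℂ) * Complex.I by push_cast; ring,
    Complex.norm_exp_ofReal_mul_I, mul_one]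

theorem norm_expSum_le_div {n : ℕ} {c : ℕ → ℝ} (hc0 : ∀ k, n ≤ k → 0 ≤ c k)
    (hc : AntitoneOn c (Ici n)) (M : ℕ) {x : ℝ} (hx : 0 < x) (hxπ : x ≤ π) :
    ‖expSum n M c x‖ ≤ c n * (π / x) := by
  have hz : ‖Complex.exp (Complex.I * x)‖ = 1 := Complex.norm_exp_I_mul_ofReal x
  have h := norm_one_sub_mul_sum_le hc0 hc hz M
  have he : ∑ k ∈ Finset.Ico n M, (c k : ℂ) * Complex.exp (Complex.I * x) ^ k =
      expSum n M c x := by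
    refine Finset.sum_congr rfl fun k _ => ?_
    rw [← Complex.exp_nat_mul]
    congr 2
    ring
  rw [he, norm_mul, norm_sub_rev, Complex.norm_exp_I_mul_ofReal_sub_one] at h
  have hsin : 2 / π * (x / 2) ≤ Real.sin (x / 2) := Real.mul_le_sin (by linarith) (by linarith)
  have hpos := Real.pi_pos
  have h2 : 2 * (x / π) ≤ ‖2 * Real.sin (x / 2)‖ := by
    refine le_trans ?_ (le_abs_self _)
    calc 2 * (x / π) = 2 * (2 / π * (x / 2)) := by ring
      _ ≤ _ := by gcongr
  have h3 : 2 * (x / π) * ‖expSum n M c x‖ ≤ 2 * c n :=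
    (mul_le_mul_of_nonneg_right h2 (norm_nonneg _)).trans h
  have h4 : x / π * ‖expSum n M c x‖ ≤ c n := by linarith
  calc ‖expSum n M c x‖ = x / π * ‖expSum n M c x‖ * (π / x) := by field_simp
    _ ≤ c n * (π / x) := by gcongr

/-- On `(π / (N + 1), π / N]` with `N ≥ n` the first `N` frequencies are estimated trivially and
the remaining ones by Abel summation. -/
theorem norm_expSum_le_of_le {n : ℕ} {c : ℕ → ℝ} (hc0 : ∀ k, n ≤ k → 0 ≤ c k)
    (hc : AntitoneOn c (Ici n)) (M : ℕ) {N : ℕ} (hN : n ≤ N) {x : ℝ}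
    (hx : x ∈ Ioc (π / (N + 1 : ℝ)) (π / N)) :
    ‖expSum n M c x‖ ≤ ∑ k ∈ Finset.Ico n (N + 1), c k + (N + 1) * c N := by
  have hN1 : (0 : ℝ) < (N : ℝ) + 1 := by positivity
  have hpos := Real.pi_pos
  have hx0 : 0 < x := lt_trans (by positivity) hx.1
  have hcN := hc0 N hN
  rcases le_total M (N + 1) with hM | hM
  · calc ‖expSum n M c x‖ ≤ ∑ k ∈ Finset.Ico n M, c k := norm_expSum_le_sum hc0 M x
      _ ≤ ∑ k ∈ Finset.Ico n (N + 1), c k :=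
        Finset.sum_le_sum_of_subset_of_nonneg (Finset.Ico_subset_Ico le_rfl hM)
          fun k hk _ => hc0 k (Finset.mem_Ico.1 hk).1
      _ ≤ _ := le_add_of_nonneg_right (by positivity)
  · have hsplit : expSum n M c x = expSum n (N + 1) c x + expSum (N + 1) M c x :=
      (Finset.sum_Ico_consecutive _ (by omega) hM).symm
    have hxπ : x ≤ π := by
      rcases Nat.eq_zero_or_pos N with h0 | h0
      · rw [h0, Nat.cast_zero, div_zero] at hx
        exact absurd hx.2 (not_le.2 hx0)
      · exact hx.2.trans (div_le_self hpos.le (by exact_mod_cast h0))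
    have h2 := norm_expSum_le_div (n := N + 1) (c := c) (fun k hk => hc0 k (by omega))
      (hc.mono (Ici_subset_Ici.2 (by omega))) M hx0 hxπ
    have h3 : c (N + 1) ≤ c N := hc hN (mem_Ici.2 (by omega)) (by omega)
    have h4 : π / x ≤ N + 1 := by
      rw [div_le_iff₀ hx0]
      have := (div_lt_iff₀ hN1).1 hx.1
      linarith
    rw [hsplit]
    refine (norm_add_le _ _).trans (add_le_add (norm_expSum_le_sum hc0 _ x) (h2.trans ?_))
    calc c (N + 1) * (π / x) ≤ c N * (N + 1) := by
          apply mul_le_mul h3 h4 (by positivity) hcN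
      _ = _ := mul_comm _ _

theorem norm_expSum_le_of_lt {n : ℕ} {c : ℕ → ℝ} (hc0 : ∀ k, n ≤ k → 0 ≤ c k)
    (hc : AntitoneOn c (Ici n)) (M : ℕ) {N : ℕ} (hN : 1 ≤ N) {x : ℝ}
    (hx : x ∈ Ioc (π / (N + 1 : ℝ)) (π / N)) :
    ‖expSum n M c x‖ ≤ (N + 1) * c n := by
  have hN1 : (0 : ℝ) < (N : ℝ) + 1 := by positivity
  have hpos := Real.pi_pos
  have hx0 : 0 < x := lt_trans (by positivity) hx.1
  have hxπ : x ≤ π := hx.2.trans (div_le_self hpos.le (by exact_mod_cast hN))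
  have h4 : π / x ≤ N + 1 := by
    rw [div_le_iff₀ hx0]
    have := (div_lt_iff₀ hN1).1 hx.1
    linarith
  calc ‖expSum n M c x‖ ≤ c n * (π / x) := norm_expSum_le_div hc0 hc M hx0 hxπ
    _ ≤ c n * (N + 1) := mul_le_mul_of_nonneg_left h4 (hc0 n le_rfl)
    _ = _ := mul_comm _ _

theorem Ioc_zero_pi_subset_iUnion :
    Ioc 0 π ⊆ ⋃ j : ℕ, Ioc (π / ((j + 1 : ℕ) + 1 : ℝ)) (π / ((j + 1 : ℕ) : ℝ)) := by
  intro x hx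
  have h1 : 1 ≤ π / x := (one_le_div hx.1).2 hx.2
  have hfl : 1 ≤ ⌊π / x⌋₊ := Nat.le_floor (by simpa using h1)
  obtain ⟨j, hj⟩ : ∃ j, ⌊π / x⌋₊ = j + 1 := ⟨_, (Nat.sub_add_cancel hfl).symm⟩
  refine mem_iUnion.2 ⟨j, ?_, ?_⟩
  · have h2 := Nat.lt_floor_add_one (π / x)
    rw [hj] at h2
    rw [div_lt_iff₀ (by positivity)]
    have := (div_lt_iff₀ hx.1).1 h2
    linarith
  · have h2 := Nat.floor_le (zero_le_one.trans h1)
    rw [hj] at h2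
    rw [le_div_iff₀ (by positivity)]
    have := (le_div_iff₀ hx.1).1 h2
    linarith

theorem xi_pos {r : ℝ} (hr : 1 < r) : 0 < xi r :=
  lt_max_of_lt_right (by have := Real.pi_pos; positivity)

theorem four_pi_le_min_mul_xi_rpow {r : ℝ} (hr : 1 < r) : 4 * π ≤ min 1 (r - 1) * xi r ^ r := by
  have hpos := Real.pi_pos
  have hr0 : 0 < r := by linarith
  have hr1 : 0 < r - 1 := by linarith
  rcases le_total (r - 1) 1 with h | h
  · rw [min_eq_right h]
    have h1 : (4 * (π / (r - 1)) ^ (1 / r)) ^ r ≤ xi r ^ r :=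
      Real.rpow_le_rpow (by positivity) (le_max_left _ _) hr0.le
    rw [Real.mul_rpow (by norm_num) (by positivity), ← Real.rpow_mul (by positivity),
      one_div_mul_cancel hr0.ne', Real.rpow_one] at h1
    have h4 : (4 : ℝ) ≤ 4 ^ r := by
      simpa using Real.rpow_le_rpow_of_exponent_le (x := 4) (by norm_num) hr.le
    calc 4 * π ≤ 4 ^ r * π := by gcongr
      _ = (r - 1) * (4 ^ r * (π / (r - 1))) := by field_simp
      _ ≤ _ := by gcongr
  · rw [min_eq_left h, one_mul]
    have h1 : (14 * (8 * π) ^ (1 / r) * r) ^ r ≤ xi r ^ r :=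
      Real.rpow_le_rpow (by positivity) (le_max_right _ _) hr0.le
    rw [Real.mul_rpow (by positivity) (by positivity), Real.mul_rpow (by norm_num) (by positivity),
      ← Real.rpow_mul (by positivity), one_div_mul_cancel hr0.ne', Real.rpow_one] at h1
    have h2 : (1 : ℝ) ≤ 14 ^ r := Real.one_le_rpow (by norm_num) hr0.le
    have h3 : (1 : ℝ) ≤ r ^ r := Real.one_le_rpow hr.le hr0.le
    have h4 : 1 * (8 * π) * 1 ≤ 14 ^ r * (8 * π) * r ^ r := by gcongr
    linarith

theorem pi_mul_le_xi_rpow {r : ℝ} (hr : 1 < r) : π * (4 * r) ^ r ≤ xi r ^ r := by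
  have hpos := Real.pi_pos
  have hr0 : 0 < r := by linarith
  have h1 : (14 * (8 * π) ^ (1 / r) * r) ^ r ≤ xi r ^ r :=
    Real.rpow_le_rpow (by positivity) (le_max_right _ _) hr0.le
  rw [Real.mul_rpow (by positivity) (by positivity), Real.mul_rpow (by norm_num) (by positivity),
    ← Real.rpow_mul (by positivity), one_div_mul_cancel hr0.ne', Real.rpow_one] at h1
  rw [Real.mul_rpow (by norm_num) hr0.le]
  have h2 : (4 : ℝ) ^ r ≤ 14 ^ r := Real.rpow_le_rpow (by norm_num) (by norm_num) hr0.le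
  calc π * (4 ^ r * r ^ r) ≤ (8 * π) * (14 ^ r * r ^ r) := by gcongr; linarith
    _ = 14 ^ r * (8 * π) * r ^ r := by ring
    _ ≤ _ := h1

theorem add_rpow_le {u v r : ℝ} (hu : 0 ≤ u) (hv : 0 ≤ v) (hr : 1 ≤ r) :
    (u + v) ^ r ≤ 2 ^ (r - 1) * (u ^ r + v ^ r) := by
  lift u to NNReal using hu
  lift v to NNReal using hv
  exact_mod_cast NNReal.rpow_add_le_mul_rpow_add_rpow u v hr

/-- The pieces to the left of `π / n` contribute at most the multiple `B` of
`c_n ^ r n ^ (r - 1)`. -/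
theorem sum_low_pieces_le {r : ℝ} (hr : 1 < r) {n : ℕ} {d B : ℝ} (hd : 0 ≤ d)
    (hB : d ^ r * (n : ℝ) ^ (r - 1) ≤ B) :
    ∑ N ∈ Finset.Ico 1 n, (((N : ℝ) + 1) * d) ^ r * (π / ((N : ℝ) * (N + 1))) ≤
      xi r ^ r / 2 * B := by
  have hpos := Real.pi_pos
  have hm : 0 < min 1 (r - 1) := lt_min one_pos (by linarith)
  have h1 : ∀ N ∈ Finset.Ico 1 n, (((N : ℝ) + 1) * d) ^ r * (π / ((N : ℝ) * (N + 1))) ≤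
      2 * π * d ^ r * ((N : ℝ) + 1) ^ (r - 2) := by
    intro N hN
    have hN1 : (1 : ℝ) ≤ N := by exact_mod_cast (Finset.mem_Ico.1 hN).1
    have hp : ((N : ℝ) + 1) ^ r = ((N : ℝ) + 1) ^ (r - 2) * ((N : ℝ) + 1) ^ 2 := by
      rw [← Real.rpow_natCast _ 2, ← Real.rpow_add (by positivity)]
      congr 1
      push_cast
      ring
    rw [Real.mul_rpow (by positivity) hd, hp]
    have h2 : ((N : ℝ) + 1) ^ 2 * (π / ((N : ℝ) * (N + 1))) ≤ 2 * π := by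
      rw [mul_div_assoc', div_le_iff₀ (by positivity)]
      nlinarith [mul_nonneg hpos.le (mul_nonneg (by linarith : (0 : ℝ) ≤ N - 1)
        (by linarith : (0 : ℝ) ≤ (N : ℝ) + 1))]
    calc ((N : ℝ) + 1) ^ (r - 2) * ((N : ℝ) + 1) ^ 2 * d ^ r * (π / ((N : ℝ) * (N + 1)))
        = ((N : ℝ) + 1) ^ (r - 2) * d ^ r * (((N : ℝ) + 1) ^ 2 * (π / ((N : ℝ) * (N + 1)))) := by
          ring
      _ ≤ ((N : ℝ) + 1) ^ (r - 2) * d ^ r * (2 * π) := by gcongr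
      _ = _ := by ring
  have h2 : ∑ N ∈ Finset.Ico 1 n, ((N : ℝ) + 1) ^ (r - 2) ≤
      ∑ j ∈ Finset.range n, ((j : ℝ) + 1) ^ (r - 2) := by
    refine Finset.sum_le_sum_of_subset_of_nonneg (fun k hk => ?_) fun k _ _ => by positivity
    exact Finset.mem_range.2 (Finset.mem_Ico.1 hk).2
  have h3 := sum_rpow_sub_two_le hr n
  have hdr : 0 ≤ d ^ r := Real.rpow_nonneg hd r
  have hB0 : 0 ≤ B := le_trans (by positivity) hB
  refine le_of_mul_le_mul_left ?_ hm
  calc min 1 (r - 1) *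
        ∑ N ∈ Finset.Ico 1 n, (((N : ℝ) + 1) * d) ^ r * (π / ((N : ℝ) * (N + 1)))
      ≤ min 1 (r - 1) * (2 * π * d ^ r * ∑ j ∈ Finset.range n, ((j : ℝ) + 1) ^ (r - 2)) := by
        refine mul_le_mul_of_nonneg_left ((Finset.sum_le_sum h1).trans ?_) hm.le
        rw [← Finset.mul_sum]
        exact mul_le_mul_of_nonneg_left h2 (by positivity)
    _ = 2 * π * d ^ r * (min 1 (r - 1) * ∑ j ∈ Finset.range n, ((j : ℝ) + 1) ^ (r - 2)) := by
        ring
    _ ≤ 2 * π * d ^ r * (n : ℝ) ^ (r - 1) := by gcongr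
    _ = 4 * π / 2 * (d ^ r * (n : ℝ) ^ (r - 1)) := by ring
    _ ≤ min 1 (r - 1) * xi r ^ r / 2 * B := by
        have h4 := four_pi_le_min_mul_xi_rpow hr
        refine mul_le_mul (by gcongr) hB (by positivity) ?_
        linarith
    _ = _ := by ring

/-- The pieces to the right of `π / n` are controlled by Hardy's inequality. -/
theorem sum_high_pieces_le {r : ℝ} (hr : 1 < r) {n : ℕ} (hn : 1 ≤ n) {c : ℕ → ℝ}
    (hc0 : ∀ k, n ≤ k → 0 ≤ c k) (K : ℕ) {T : ℝ}
    (hT : ∑ k ∈ Finset.Ico n K, c k ^ r * (k : ℝ) ^ (r - 2) ≤ T) :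
    ∑ N ∈ Finset.Ico n K, (∑ k ∈ Finset.Ico n (N + 1), c k + (N + 1) * c N) ^ r *
      (π / ((N : ℝ) * (N + 1))) ≤ xi r ^ r / 2 * T := by
  have hpos := Real.pi_pos
  have hr0 : 0 < r := by linarith
  have hterm : ∀ N ∈ Finset.Ico n K,
      (∑ k ∈ Finset.Ico n (N + 1), c k + (N + 1) * c N) ^ r * (π / ((N : ℝ) * (N + 1))) ≤
      π * 2 ^ (r - 1) * ((∑ k ∈ Finset.Ico n (N + 1), c k) ^ r / ((N : ℝ) * (N + 1))) +
        π * 2 ^ (r - 1) * 2 ^ (r - 1) * (c N ^ r * (N : ℝ) ^ (r - 2)) := by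
    intro N hN
    obtain ⟨hnN, -⟩ := Finset.mem_Ico.1 hN
    have hN1 : (1 : ℝ) ≤ N := by exact_mod_cast hn.trans hnN
    have hN0 : (0 : ℝ) < N := by linarith
    have hcN := hc0 N hnN
    have hA : 0 ≤ ∑ k ∈ Finset.Ico n (N + 1), c k :=
      Finset.sum_nonneg fun k hk => hc0 k (Finset.mem_Ico.1 hk).1
    set A := ∑ k ∈ Finset.Ico n (N + 1), c k
    have h1 : (A + (N + 1) * c N) ^ r ≤ 2 ^ (r - 1) * (A ^ r + ((N + 1) * c N) ^ r) :=
      add_rpow_le hA (by positivity) hr.le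
    have h2 : ((N : ℝ) + 1) ^ r ≤ 2 ^ (r - 1) * (N : ℝ) ^ (r - 2) * ((N : ℝ) * (N + 1)) := by
      have e1 : ((N : ℝ) + 1) ^ r = ((N : ℝ) + 1) ^ (r - 1) * ((N : ℝ) + 1) := by
        rw [← Real.rpow_add_one (by positivity)]
        congr 1
        ring
      have e2 : (N : ℝ) ^ (r - 1) = (N : ℝ) ^ (r - 2) * N := by
        rw [← Real.rpow_add_one (by positivity)]
        congr 1
        ring
      have e3 : ((N : ℝ) + 1) ^ (r - 1) ≤ (2 * N) ^ (r - 1) :=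
        Real.rpow_le_rpow (by positivity) (by linarith) (by linarith)
      rw [Real.mul_rpow (by norm_num) hN0.le, e2] at e3
      rw [e1]
      calc ((N : ℝ) + 1) ^ (r - 1) * ((N : ℝ) + 1)
          ≤ 2 ^ (r - 1) * ((N : ℝ) ^ (r - 2) * N) * ((N : ℝ) + 1) := by gcongr
        _ = _ := by ring
    have hD : (0 : ℝ) < (N : ℝ) * (N + 1) := by positivity
    calc (A + (N + 1) * c N) ^ r * (π / ((N : ℝ) * (N + 1)))
        ≤ 2 ^ (r - 1) * (A ^ r + ((N + 1) * c N) ^ r) * (π / ((N : ℝ) * (N + 1))) := by gcongr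
      _ = π * 2 ^ (r - 1) * (A ^ r / ((N : ℝ) * (N + 1))) + π * 2 ^ (r - 1) * c N ^ r *
            (((N : ℝ) + 1) ^ r / ((N : ℝ) * (N + 1))) := by
          rw [Real.mul_rpow (by positivity) hcN]
          ring
      _ ≤ π * 2 ^ (r - 1) * (A ^ r / ((N : ℝ) * (N + 1))) + π * 2 ^ (r - 1) * c N ^ r *
            (2 ^ (r - 1) * (N : ℝ) ^ (r - 2)) := by
          have : ((N : ℝ) + 1) ^ r / ((N : ℝ) * (N + 1)) ≤ 2 ^ (r - 1) * (N : ℝ) ^ (r - 2) :=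
            (div_le_iff₀ hD).2 h2
          have hcr : 0 ≤ c N ^ r := Real.rpow_nonneg hcN r
          gcongr
      _ = _ := by ring
  have hH := hardy_sum_le hr hn hc0 K
  have hT0 : 0 ≤ T := le_trans (Finset.sum_nonneg fun k hk => mul_nonneg
    (Real.rpow_nonneg (hc0 k (Finset.mem_Ico.1 hk).1) _) (by positivity)) hT
  have h2 : (2 : ℝ) ^ (r - 1) = 2 ^ r / 2 := Real.rpow_sub_one (by norm_num) r
  have h2r : (2 : ℝ) ^ r ≤ (2 * r) ^ r := Real.rpow_le_rpow (by norm_num) (by linarith) hr0.le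
  have h4r : (4 * r) ^ r = 2 ^ r * (2 * r) ^ r := by
    rw [← Real.mul_rpow (by norm_num) (by positivity)]
    congr 1
    ring
  calc _ ≤ _ := Finset.sum_le_sum hterm
    _ = π * 2 ^ (r - 1) *
          ∑ N ∈ Finset.Ico n K, (∑ k ∈ Finset.Ico n (N + 1), c k) ^ r / ((N : ℝ) * (N + 1)) +
        π * 2 ^ (r - 1) * 2 ^ (r - 1) * ∑ N ∈ Finset.Ico n K, c N ^ r * (N : ℝ) ^ (r - 2) := by
        rw [Finset.sum_add_distrib, ← Finset.mul_sum, ← Finset.mul_sum]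
    _ ≤ π * 2 ^ (r - 1) * ((2 * r) ^ r / 2 * T) + π * 2 ^ (r - 1) * 2 ^ (r - 1) * T := by
        have := hH.trans (mul_le_mul_of_nonneg_left hT (by positivity))
        gcongr
    _ = π * (2 ^ r * ((2 * r) ^ r + 2 ^ r)) / 4 * T := by rw [h2]; ring
    _ ≤ π * (2 ^ r * ((2 * r) ^ r + (2 * r) ^ r)) / 4 * T := by gcongr
    _ = π * (4 * r) ^ r / 2 * T := by rw [h4r]; ring
    _ ≤ xi r ^ r / 2 * T := by
        have := pi_mul_le_xi_rpow hr
        gcongr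

theorem lintegral_Ioc_norm_expSum_rpow_le {r : ℝ} (hr : 1 < r) {n : ℕ} (hn : 1 ≤ n) {c : ℕ → ℝ}
    (hc0 : ∀ k, n ≤ k → 0 ≤ c k) (hc : AntitoneOn c (Ici n)) {B T : ℝ}
    (hB : c n ^ r * (n : ℝ) ^ (r - 1) ≤ B)
    (hT : ∀ K, ∑ k ∈ Finset.Ico n K, c k ^ r * (k : ℝ) ^ (r - 2) ≤ T) (M : ℕ) :
    ∫⁻ x in Ioc 0 π, ENNReal.ofReal (‖expSum n M c x‖ ^ r) ≤
      ENNReal.ofReal (xi r ^ r / 2 * (B + T)) := by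
  have hpos := Real.pi_pos
  have hr0 : 0 < r := by linarith
  set b : ℕ → ℝ := fun N => if N < n then ((N : ℝ) + 1) * c n
    else ∑ k ∈ Finset.Ico n (N + 1), c k + (N + 1) * c N with hb
  have hb0 : ∀ N, 0 ≤ b N := by
    intro N
    simp only [hb]
    split_ifs with h
    · exact mul_nonneg (by positivity) (hc0 n le_rfl)
    · exact add_nonneg (Finset.sum_nonneg fun k hk => hc0 k (Finset.mem_Ico.1 hk).1)
        (mul_nonneg (by positivity) (hc0 N (by omega)))
  have hpt : ∀ N : ℕ, 1 ≤ N → ∀ x ∈ Ioc (π / (N + 1 : ℝ)) (π / N), ‖expSum n M c x‖ ≤ b N := by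
    intro N hN x hx
    simp only [hb]
    split_ifs with h
    · exact norm_expSum_le_of_lt hc0 hc M hN hx
    · exact norm_expSum_le_of_le hc0 hc M (by omega) hx
  have hpiece : ∀ j : ℕ, ∫⁻ x in Ioc (π / ((j + 1 : ℕ) + 1 : ℝ)) (π / ((j + 1 : ℕ) : ℝ)),
      ENNReal.ofReal (‖expSum n M c x‖ ^ r) ≤
        ENNReal.ofReal (b (j + 1) ^ r * (π / (((j + 1 : ℕ) : ℝ) * ((j + 1 : ℕ) + 1)))) := by
    intro j
    calc _ ≤ ∫⁻ x in Ioc (π / ((j + 1 : ℕ) + 1 : ℝ)) (π / ((j + 1 : ℕ) : ℝ)),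
          ENNReal.ofReal (b (j + 1) ^ r) := by
          refine setLIntegral_mono measurable_const fun x hx => ?_
          exact ENNReal.ofReal_le_ofReal (Real.rpow_le_rpow (norm_nonneg _)
            (hpt (j + 1) (by omega) x hx) hr0.le)
      _ = _ := by
          rw [setLIntegral_const, Real.volume_Ioc,
            ← ENNReal.ofReal_mul (Real.rpow_nonneg (hb0 _) _)]
          congr 2
          push_cast
          field_simp
          ring
  refine (lintegral_mono_set Ioc_zero_pi_subset_iUnion).trans
    ((lintegral_iUnion_le _ _).trans (ENNReal.tsum_le_of_sum_range_le fun K => ?_))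
  refine (Finset.sum_le_sum fun j _ => hpiece j).trans ?_
  rw [← ENNReal.ofReal_sum_of_nonneg fun j _ =>
    mul_nonneg (Real.rpow_nonneg (hb0 _) _) (by positivity)]
  refine ENNReal.ofReal_le_ofReal ?_
  set F : ℕ → ℝ := fun N => b N ^ r * (π / ((N : ℝ) * (N + 1))) with hF
  have hF0 : ∀ N, 0 ≤ F N := fun N => mul_nonneg (Real.rpow_nonneg (hb0 _) _) (by positivity)
  calc ∑ j ∈ Finset.range K, F (j + 1) = ∑ N ∈ Finset.Ico 1 (K + 1), F N := by
        rw [Finset.sum_Ico_eq_sum_range]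
        simp [add_comm]
    _ ≤ ∑ N ∈ Finset.Ico 1 (K + n), F N :=
        Finset.sum_le_sum_of_subset_of_nonneg (Finset.Ico_subset_Ico le_rfl (by omega))
          fun N _ _ => hF0 N
    _ = ∑ N ∈ Finset.Ico 1 n, F N + ∑ N ∈ Finset.Ico n (K + n), F N :=
        (Finset.sum_Ico_consecutive _ hn (by omega)).symm
    _ ≤ xi r ^ r / 2 * B + xi r ^ r / 2 * T := by
        refine add_le_add ?_ ?_
        · refine le_trans (Finset.sum_le_sum fun N hN => le_of_eq ?_)
            (sum_low_pieces_le hr (hc0 n le_rfl) hB)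
          simp only [hF, hb, if_pos (Finset.mem_Ico.1 hN).2]
        · refine le_trans (Finset.sum_le_sum fun N hN => le_of_eq ?_)
            (sum_high_pieces_le hr hn hc0 (K + n) (hT _))
          simp only [hF, hb, if_neg (not_lt.2 (Finset.mem_Ico.1 hN).1)]
    _ = _ := by ring

/-- The Hardy–Littlewood bound: if `c` is nonnegative and decreasing from `n` on, the `L_r` norm
over a period of any partial sum `∑_{n ≤ k < M} c_k e^{ikx}` is controlled by `∑ c_k ^ r k ^ (r-2)`
and by the boundary quantity `c_n ^ r n ^ (r - 1)`, which accounts for the region `|x| > π / n`. -/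
theorem lintegral_norm_expSum_rpow_le {r : ℝ} (hr : 1 < r) {n : ℕ} (hn : 1 ≤ n) {c : ℕ → ℝ}
    (hc0 : ∀ k, n ≤ k → 0 ≤ c k) (hc : AntitoneOn c (Ici n)) {B T : ℝ}
    (hB : c n ^ r * (n : ℝ) ^ (r - 1) ≤ B)
    (hT : ∀ K, ∑ k ∈ Finset.Ico n K, c k ^ r * (k : ℝ) ^ (r - 2) ≤ T) (M : ℕ) :
    ∫⁻ x, ENNReal.ofReal (‖expSum n M c x‖ ^ r) ∂periodMeasure ≤
      ENNReal.ofReal (xi r ^ r * (B + T)) := by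
  have hpos := Real.pi_pos
  have hhalf := lintegral_Ioc_norm_expSum_rpow_le hr hn hc0 hc hB hT M
  set G : ℝ → ℝ≥0∞ := fun x => ENNReal.ofReal (‖expSum n M c x‖ ^ r) with hG
  have hGm : Measurable G := by
    have := (continuous_expSum n M c).measurable
    fun_prop
  have hB0 : 0 ≤ B :=
    le_trans (mul_nonneg (Real.rpow_nonneg (hc0 n le_rfl) _) (by positivity)) hB
  have hT0 : 0 ≤ T := by simpa using hT 0
  have hsymm : ∫⁻ x in Ico π (2 * π), G x = ∫⁻ x in Ioc 0 π, G x := by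
    have h := (Measure.measurePreserving_sub_left volume (2 * π)).setLIntegral_comp_preimage
      (measurableSet_Ioc (a := 0) (b := π)) hGm
    rw [Set.preimage_const_sub_Ioc, sub_zero, show 2 * π - π = π by ring] at h
    rw [← h]
    refine lintegral_congr fun x => ?_
    simp only [hG, norm_expSum_two_pi_sub]
  have hx : 0 < xi r := xi_pos hr
  calc ∫⁻ x, G x ∂periodMeasure = ∫⁻ x in Ico 0 π ∪ Ico π (2 * π), G x := by
        rw [Ico_union_Ico_eq_Ico hpos.le (by linarith), periodMeasure]
    _ ≤ (∫⁻ x in Ico 0 π, G x) + ∫⁻ x in Ico π (2 * π), G x := lintegral_union_le _ _ _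
    _ = (∫⁻ x in Ioc 0 π, G x) + ∫⁻ x in Ioc 0 π, G x := by
        rw [hsymm, setLIntegral_congr Ico_ae_eq_Ioc]
    _ ≤ ENNReal.ofReal (xi r ^ r / 2 * (B + T)) + ENNReal.ofReal (xi r ^ r / 2 * (B + T)) :=
        add_le_add hhalf hhalf
    _ = _ := by
        rw [← ENNReal.ofReal_add (by positivity) (by positivity)]
        congr 1
        ring

/-- The cosine polynomial `∑_{n ≤ k < M} c_k cos (k x - θ)`. -/
noncomputable def cosPoly (n M : ℕ) (c : ℕ → ℝ) (θ : ℝ) (x : ℝ) : ℝ :=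
  ∑ k ∈ Finset.Ico n M, c k * Real.cos (k * x - θ)

theorem continuous_cosPoly (n M : ℕ) (c : ℕ → ℝ) (θ : ℝ) : Continuous (cosPoly n M c θ) := by
  unfold cosPoly
  fun_prop

theorem cosPoly_periodic (n M : ℕ) (c : ℕ → ℝ) (θ : ℝ) :
    Function.Periodic (cosPoly n M c θ) (2 * π) := by
  intro x
  refine Finset.sum_congr rfl fun k _ => ?_
  rw [show (k : ℝ) * (x + 2 * π) - θ = k * x - θ + k * (2 * π) by ring,
    Real.cos_add_nat_mul_two_pi]

theorem cosPoly_eq_re (n M : ℕ) (c : ℕ → ℝ) (θ x : ℝ) :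
    cosPoly n M c θ x = (Complex.exp (-(Complex.I * θ)) * expSum n M c x).re := by
  simp only [cosPoly, expSum, Finset.mul_sum, Complex.re_sum]
  refine Finset.sum_congr rfl fun k _ => ?_
  rw [mul_left_comm, ← Complex.exp_add, Complex.re_ofReal_mul,
    show -(Complex.I * θ) + Complex.I * k * x = ((k * x - θ : ℝ) : ℂ) * Complex.I by
      push_cast; ring, Complex.exp_ofReal_mul_I_re]

theorem abs_cosPoly_le (n M : ℕ) (c : ℕ → ℝ) (θ x : ℝ) :
    |cosPoly n M c θ x| ≤ ‖expSum n M c x‖ := by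
  rw [cosPoly_eq_re]
  refine (Complex.abs_re_le_norm _).trans ?_
  rw [norm_mul, show -(Complex.I * (θ : ℂ)) = ((-θ : ℝ) : ℂ) * Complex.I by push_cast; ring,
    Complex.norm_exp_ofReal_mul_I, one_mul]

theorem pnorm_cosPoly_le {r : ℝ} (hr : 1 < r) {n : ℕ} (hn : 1 ≤ n) {c : ℕ → ℝ}
    (hc0 : ∀ k, n ≤ k → 0 ≤ c k) (hc : AntitoneOn c (Ici n)) {B T : ℝ}
    (hB : c n ^ r * (n : ℝ) ^ (r - 1) ≤ B)
    (hT : ∀ K, ∑ k ∈ Finset.Ico n K, c k ^ r * (k : ℝ) ^ (r - 2) ≤ T) (M : ℕ) (θ : ℝ) :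
    pnorm (cosPoly n M c θ) (ENNReal.ofReal r) ≤ ENNReal.ofReal (xi r * (B + T) ^ (1 / r)) := by
  have hr0 : 0 < r := by linarith
  have hB0 : 0 ≤ B :=
    le_trans (mul_nonneg (Real.rpow_nonneg (hc0 n le_rfl) _) (by positivity)) hB
  have hT0 : 0 ≤ T := by simpa using hT 0
  have hx : 0 < xi r := xi_pos hr
  have h0 : ENNReal.ofReal r ≠ 0 := by simpa using hr0
  rw [pnorm, eLpNorm_eq_lintegral_rpow_enorm_toReal h0 ENNReal.ofReal_ne_top,
    ENNReal.toReal_ofReal hr0.le]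
  calc _ ≤ (ENNReal.ofReal (xi r ^ r * (B + T))) ^ (1 / r) := by
        refine ENNReal.rpow_le_rpow (le_trans (lintegral_mono fun x => ?_)
          (lintegral_norm_expSum_rpow_le hr hn hc0 hc hB hT M)) (by positivity)
        rw [← ofReal_norm, ENNReal.ofReal_rpow_of_nonneg (norm_nonneg _) hr0.le]
        exact ENNReal.ofReal_le_ofReal (Real.rpow_le_rpow (norm_nonneg _)
          (abs_cosPoly_le n M c θ x) hr0.le)
    _ = _ := by
        rw [ENNReal.ofReal_rpow_of_nonneg (by positivity) (by positivity),
          Real.mul_rpow (by positivity) (by positivity), ← Real.rpow_mul hx.le,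
          mul_one_div_cancel hr0.ne', Real.rpow_one]

/-! ### Growth of `g` and of the tail sums -/

theorem antitoneOn_of_mem_frakM {g : ℝ → ℝ} (hg : g ∈ frakM) : AntitoneOn g (Ici 1) := by
  obtain ⟨hpos, -, hconv, hlim⟩ := hg
  intro x hx y hy hxy
  by_contra! hlt
  have hxy' : x < y := lt_of_le_of_ne hxy fun h => by simp [h] at hlt
  -- A convex function that increases once stays above the value reached.
  have hbig : ∀ z, y < z → g y ≤ g z := by
    intro z hz
    have h := hconv.slope_mono_adjacent hx (mem_Ici.2 ((mem_Ici.1 hy).trans hz.le)) hxy' hz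
    have h1 : 0 < (g y - g x) / (y - x) := div_pos (by linarith) (by linarith)
    have h2 := (div_pos_iff_of_pos_right (sub_pos.2 hz)).1 (h1.trans_le h)
    linarith
  have hev : ∀ᶠ z in atTop, g y ≤ g z := (eventually_gt_atTop y).mono hbig
  have := ge_of_tendsto hlim hev
  exact absurd (hpos y hy) (not_lt.2 this)

theorem alphaInf_le_alpha {g : ℝ → ℝ} (hg : g ∈ frakM₀) {t : ℝ} (ht : 1 ≤ t) :
    alphaInf g 1 ≤ alpha g t := by
  obtain ⟨-, K, -, hK⟩ := hg
  have hb : BddBelow (range fun t : Ici ((1 : ℕ) : ℝ) => alpha g t) :=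
    ⟨K, by rintro _ ⟨u, rfl⟩; exact hK u (by simpa using u.2)⟩
  exact ciInf_le hb ⟨t, by simpa using ht⟩

/-- If `α(g; t) ≥ a` for all `t ≥ 1`, then `g(t) t ^ (1 / a)` is nondecreasing: its right derivative
is nonnegative. The bound on `α` also guarantees that the right derivative of `g` exists and does
not vanish, since otherwise `alpha g t` would be the junk value `0`. -/
theorem mul_rpow_le_mul_rpow {g : ℝ → ℝ} (hg : g ∈ frakM₀) (ha : 0 < alphaInf g 1) {x y : ℝ}
    (hx : 1 ≤ x) (hxy : x ≤ y) :
    g x * x ^ (1 / alphaInf g 1) ≤ g y * y ^ (1 / alphaInf g 1) := by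
  set a := alphaInf g 1 with ha'
  obtain ⟨hpos, hcont, -, -⟩ := hg.1
  set D : ℝ → ℝ := fun t => derivWithin g (Ioi t) t with hD
  have hbound : ∀ t, 1 ≤ t → D t ≠ 0 ∧ t * |D t| * a ≤ g t := by
    intro t ht
    have h := alphaInf_le_alpha hg ht
    rw [← ha', alpha] at h
    have hne : D t ≠ 0 := by
      intro h0
      simp only [hD] at h0
      rw [h0, abs_zero, mul_zero, div_zero] at h
      exact absurd ha (not_lt.2 h)
    have hden : 0 < t * |D t| := mul_pos (by linarith) (abs_pos.2 hne)
    refine ⟨hne, ?_⟩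
    rw [mul_comm]
    exact (le_div_iff₀ hden).1 h
  have hder : ∀ t, 1 ≤ t → HasDerivWithinAt (fun t => -(g t * t ^ (1 / a)))
      (-(D t * t ^ (1 / a) + g t * (1 / a * t ^ (1 / a - 1)))) (Ici t) t := by
    intro t ht
    have h1 : HasDerivWithinAt g (D t) (Ici t) t :=
      hasDerivWithinAt_Ioi_iff_Ici.1
        (differentiableWithinAt_of_derivWithin_ne_zero (hbound t ht).1).hasDerivWithinAt
    have h2 : HasDerivAt (fun t : ℝ => t ^ (1 / a)) (1 / a * t ^ (1 / a - 1)) t :=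
      Real.hasDerivAt_rpow_const (Or.inl (by linarith))
    exact (h1.mul h2.hasDerivWithinAt).neg
  have hcontH : ContinuousOn (fun t => -(g t * t ^ (1 / a))) (Icc x y) := by
    refine ((hcont.mono fun t ht => hx.trans ht.1).mul ?_).neg
    exact continuousOn_id.rpow_const fun t _ => Or.inr (by positivity)
  have key := image_le_of_deriv_right_le_deriv_boundary (B := fun _ => -(g x * x ^ (1 / a)))
    (B' := fun _ => 0) hcontH (fun t ht => hder t (hx.trans ht.1)) le_rfl continuousOn_const
    (fun t _ => hasDerivWithinAt_const _ _ _) (fun t ht => ?_) (right_mem_Icc.2 hxy)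
  · exact neg_le_neg_iff.1 key
  · have ht1 : 1 ≤ t := hx.trans ht.1
    have ht0 : 0 < t := by linarith
    obtain ⟨-, h⟩ := hbound t ht1
    have hp : t ^ (1 / a) = t ^ (1 / a - 1) * t := by
      rw [← Real.rpow_add_one ht0.ne']
      congr 1
      ring
    have hP : 0 < t ^ (1 / a - 1) := Real.rpow_pos_of_pos ht0 _
    have h3 : -(t * D t) ≤ g t / a := by
      rw [le_div_iff₀ ha]
      have := neg_abs_le (D t)
      nlinarith [mul_le_mul_of_nonneg_left this (mul_pos ht0 ha).le]
    have h4 : D t * t ^ (1 / a) + g t * (1 / a * t ^ (1 / a - 1)) =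
        t ^ (1 / a - 1) * (t * D t + g t / a) := by
      rw [hp]
      ring
    rw [h4]
    have := mul_nonneg hP.le (by linarith : 0 ≤ t * D t + g t / a)
    linarith

theorem rpow_neg_sub_rpow_neg_le {q : ℝ} (hq : 0 < q) (hq1 : q ≤ 1) {x : ℝ} (hx : 0 < x) :
    x ^ (-q) - (x + 1) ^ (-q) ≤ q * (x ^ (-q) / x) := by
  have hx1 : 0 < x + 1 := by linarith
  have h1 : (x + 1) ^ q ≤ x ^ q * (1 + q * (1 / x)) := by
    have hb := rpow_one_add_le_one_add_mul_self (s := 1 / x)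
      (by have : 0 < 1 / x := by positivity
          linarith) hq.le hq1
    calc (x + 1) ^ q = (x * (1 + 1 / x)) ^ q := by
          congr 1
          field_simp
      _ = x ^ q * (1 + 1 / x) ^ q := Real.mul_rpow hx.le (by positivity)
      _ ≤ _ := by gcongr
  have hX : 0 < x ^ q := Real.rpow_pos_of_pos hx q
  have h2 : (x ^ q)⁻¹ * (1 - q * (1 / x)) ≤ ((x + 1) ^ q)⁻¹ := by
    have h3 : 0 < 1 + q * (1 / x) := by positivity
    calc (x ^ q)⁻¹ * (1 - q * (1 / x)) ≤ (x ^ q)⁻¹ * (1 + q * (1 / x))⁻¹ := by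
          gcongr
          rw [← one_div (1 + _), le_div_iff₀ h3]
          nlinarith [sq_nonneg (q * (1 / x))]
      _ = (x ^ q * (1 + q * (1 / x)))⁻¹ := by rw [mul_inv]
      _ ≤ _ := inv_anti₀ (Real.rpow_pos_of_pos hx1 q) h1
  rw [Real.rpow_neg hx.le, Real.rpow_neg hx1.le]
  have h4 : (x ^ q)⁻¹ * (1 - q * (1 / x)) = (x ^ q)⁻¹ - q * ((x ^ q)⁻¹ / x) := by ring
  linarith

/-- `∑_{k=n}^∞ g(k) ^ s / k`, the form of the tail sum in terms of `g = g_{s'}`. -/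
noncomputable def gTail (g : ℝ → ℝ) (s : ℝ) (n : ℕ) : ℝ :=
  ∑' j : ℕ, g ((n + j : ℕ) : ℝ) ^ s / ((n + j : ℕ) : ℝ)

theorem one_le_cast {n : ℕ} (hn : 1 ≤ n) : (1 : ℝ) ≤ n := by exact_mod_cast hn

section Growth

variable {g : ℝ → ℝ} {s : ℝ}

theorem gTerm_nonneg (hg : g ∈ frakM₀) {k : ℕ} (hk : 1 ≤ k) : 0 ≤ g k ^ s / k :=
  div_nonneg (Real.rpow_nonneg (hg.1.1 k (one_le_cast hk)).le _) (Nat.cast_nonneg _)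

theorem gTail_summable (hS : Summable fun k : ℕ => g k ^ s / (k : ℝ)) (n : ℕ) :
    Summable fun j : ℕ => g ((n + j : ℕ) : ℝ) ^ s / ((n + j : ℕ) : ℝ) := by
  have := (summable_nat_add_iff n).2 hS
  simpa only [add_comm n] using this

theorem gTail_nonneg (hg : g ∈ frakM₀) {n : ℕ} (hn : 1 ≤ n) : 0 ≤ gTail g s n :=
  tsum_nonneg fun _ => gTerm_nonneg hg (by omega)

theorem sum_Ico_le_gTail (hg : g ∈ frakM₀) (hS : Summable fun k : ℕ => g k ^ s / (k : ℝ))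
    {n : ℕ} (hn : 1 ≤ n) (K : ℕ) : ∑ k ∈ Finset.Ico n K, g k ^ s / (k : ℝ) ≤ gTail g s n := by
  rw [Finset.sum_Ico_eq_sum_range]
  exact (gTail_summable hS n).sum_le_tsum _ fun _ _ => gTerm_nonneg hg (by omega)

theorem tendsto_sum_Ico_gTail (hS : Summable fun k : ℕ => g k ^ s / (k : ℝ)) (n : ℕ) :
    Tendsto (fun K : ℕ => ∑ k ∈ Finset.Ico n K, g k ^ s / (k : ℝ)) atTop (𝓝 (gTail g s n)) := by
  have h := (gTail_summable hS n).hasSum.tendsto_sum_nat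
  refine (h.comp (tendsto_sub_atTop_nat n)).congr fun K => ?_
  rw [Finset.sum_Ico_eq_sum_range]
  rfl

theorem gTail_tendsto_zero : Tendsto (gTail g s) atTop (𝓝 0) := by
  have := tendsto_sum_nat_add fun k : ℕ => g k ^ s / (k : ℝ)
  refine this.congr fun n => ?_
  simp only [gTail, add_comm n]

theorem sum_Ico_add_gTail (hS : Summable fun k : ℕ => g k ^ s / (k : ℝ)) {n m : ℕ} (h : n ≤ m) :
    ∑ k ∈ Finset.Ico n m, g k ^ s / (k : ℝ) + gTail g s m = gTail g s n := by
  refine tendsto_nhds_unique (((tendsto_sum_Ico_gTail hS m).const_add _).congr' ?_)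
    (tendsto_sum_Ico_gTail hS n)
  filter_upwards [eventually_ge_atTop m] with K hK
  exact Finset.sum_Ico_consecutive _ h hK

theorem rpow_mul_rpow_le (hg : g ∈ frakM₀) (ha : 0 < alphaInf g 1) (hs : 0 < s) {n k : ℕ}
    (hn : 1 ≤ n) (hk : n ≤ k) :
    g n ^ s * (n : ℝ) ^ (s / alphaInf g 1) ≤ g k ^ s * (k : ℝ) ^ (s / alphaInf g 1) := by
  have hn' := one_le_cast hn
  have hk' := one_le_cast (hn.trans hk)
  have h := mul_rpow_le_mul_rpow hg ha hn' (Nat.cast_le.2 hk)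
  have hgn := (hg.1.1 n hn').le
  have hgk := (hg.1.1 k hk').le
  have := Real.rpow_le_rpow (by positivity) h hs.le
  rwa [Real.mul_rpow hgn (by positivity), Real.mul_rpow hgk (by positivity),
    ← Real.rpow_mul (by positivity), ← Real.rpow_mul (by positivity), one_div_mul_eq_div] at this

/-- The tail sum dominates its leading term: `g(n) ^ s ≤ (s / a) ∑_{k ≥ n} g(k) ^ s / k`, because
`g(k) ^ s` decays no faster than `k ^ (-s / a)`. -/
theorem rpow_le_mul_gTail (hg : g ∈ frakM₀) (hs : 1 < s) (hα : s < alphaInf g 1)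
    (hS : Summable fun k : ℕ => g k ^ s / (k : ℝ)) {n : ℕ} (hn : 1 ≤ n) :
    g n ^ s ≤ s / alphaInf g 1 * gTail g s n := by
  set a := alphaInf g 1 with ha
  have hs0 : 0 < s := by linarith
  have ha0 : 0 < a := by linarith
  set q := s / a with hq
  have hq0 : 0 < q := div_pos hs0 ha0
  have hq1 : q ≤ 1 := (div_le_one ha0).2 hα.le
  have hn0 : (0 : ℝ) < n := by linarith [one_le_cast hn]
  have hC : 0 ≤ g n ^ s * (n : ℝ) ^ q :=
    mul_nonneg (Real.rpow_nonneg (hg.1.1 n (one_le_cast hn)).le _) (by positivity)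
  have hfin : ∀ K, n ≤ K → g n ^ s * (n : ℝ) ^ q * ((n : ℝ) ^ (-q) - (K : ℝ) ^ (-q)) ≤
      q * ∑ k ∈ Finset.Ico n K, g k ^ s / (k : ℝ) := by
    intro K hK
    induction K, hK using Nat.le_induction with
    | base => simp
    | succ k hk ih =>
      rw [Finset.sum_Ico_succ_top hk]
      have hk0 : (0 : ℝ) < k := by linarith [one_le_cast (hn.trans hk)]
      have h1 := rpow_neg_sub_rpow_neg_le hq0 hq1 hk0
      have h2 : g n ^ s * (n : ℝ) ^ q * (k : ℝ) ^ (-q) ≤ g k ^ s := by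
        have h := rpow_mul_rpow_le hg (ha ▸ ha0) hs0 hn hk
        rw [Real.rpow_neg hk0.le, ← div_eq_mul_inv,
          div_le_iff₀ (Real.rpow_pos_of_pos hk0 q)]
        exact h
      have h3 : g n ^ s * (n : ℝ) ^ q * (q * ((k : ℝ) ^ (-q) / k)) ≤ q * (g k ^ s / k) := by
        calc _ = q * (g n ^ s * (n : ℝ) ^ q * (k : ℝ) ^ (-q) / k) := by ring
          _ ≤ _ := by gcongr
      have h4 := mul_le_mul_of_nonneg_left h1 hC
      push_cast
      linarith
  have hlim : Tendsto (fun K : ℕ => g n ^ s * (n : ℝ) ^ q * ((n : ℝ) ^ (-q) - (K : ℝ) ^ (-q)))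
      atTop (𝓝 (g n ^ s)) := by
    have h1 : Tendsto (fun K : ℕ => (K : ℝ) ^ (-q)) atTop (𝓝 0) :=
      (tendsto_rpow_neg_atTop hq0).comp tendsto_natCast_atTop_atTop
    have h2 := (h1.const_sub ((n : ℝ) ^ (-q))).const_mul (g n ^ s * (n : ℝ) ^ q)
    rwa [sub_zero, mul_assoc, ← Real.rpow_add hn0, add_neg_cancel, Real.rpow_zero, mul_one] at h2
  refine le_of_tendsto_of_tendsto hlim ((tendsto_sum_Ico_gTail hS n).const_mul q) ?_
  filter_upwards [eventually_ge_atTop n] with K hK using hfin K hK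

/-- Discarding the terms `n ≤ k < 2n` costs at most a factor `1 - s / a`. With `q = s / a` these
terms are at most `2 ^ q q` times the rest, and `(1 - q) (1 + (1 + q) q) = 1 - q ^ 3 ≤ 1`. -/
theorem one_sub_mul_gTail_le (hg : g ∈ frakM₀) (hs : 1 < s) (hα : s < alphaInf g 1)
    (hS : Summable fun k : ℕ => g k ^ s / (k : ℝ)) {n : ℕ} (hn : 1 ≤ n) :
    (1 - s / alphaInf g 1) * gTail g s n ≤ gTail g s (2 * n) := by
  have hs0 : 0 < s := by linarith
  have ha0 : 0 < alphaInf g 1 := by linarith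
  have h2n := rpow_le_mul_gTail hg hs hα hS (n := 2 * n) (by omega)
  have hgr := rpow_mul_rpow_le hg ha0 hs0 hn (k := 2 * n) (by omega)
  set q := s / alphaInf g 1 with hq
  have hq0 : 0 < q := div_pos hs0 ha0
  have hq1 : q ≤ 1 := (div_le_one ha0).2 hα.le
  have hn0 : (0 : ℝ) < n := by linarith [one_le_cast hn]
  have hblock : ∑ k ∈ Finset.Ico n (2 * n), g k ^ s / (k : ℝ) ≤ g n ^ s := by
    calc _ ≤ ∑ k ∈ Finset.Ico n (2 * n), g n ^ s / (n : ℝ) := by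
          refine Finset.sum_le_sum fun k hk => ?_
          have hnk := (Finset.mem_Ico.1 hk).1
          have hk1 := one_le_cast (hn.trans hnk)
          have hnk' : (n : ℝ) ≤ k := Nat.cast_le.2 hnk
          have h0 := (hg.1.1 k hk1).le
          have h1 : g k ≤ g n := antitoneOn_of_mem_frakM hg.1 (one_le_cast hn) hk1 hnk'
          have h2 : 0 ≤ g n := h0.trans h1
          gcongr
      _ = g n ^ s := by
          rw [Finset.sum_const, Nat.card_Ico, show 2 * n - n = n by omega, nsmul_eq_mul]
          field_simp
  have hpow : (2 : ℝ) ^ q ≤ 1 + q := by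
    have := rpow_one_add_le_one_add_mul_self (s := 1) (by norm_num) hq0.le hq1
    rw [mul_one] at this
    convert this using 2
    norm_num
  have hgn : g n ^ s ≤ g ((2 * n : ℕ) : ℝ) ^ s * 2 ^ q := by
    rw [Nat.cast_mul, Real.mul_rpow (by norm_num) hn0.le, ← mul_assoc] at hgr
    push_cast at hgr ⊢
    exact le_of_mul_le_mul_right hgr (Real.rpow_pos_of_pos hn0 q)
  have hT0 : 0 ≤ gTail g s (2 * n) := gTail_nonneg hg (by omega)
  have hsum := sum_Ico_add_gTail hS (show n ≤ 2 * n by omega)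
  have h2q : 0 < (2 : ℝ) ^ q := by positivity
  have h5 : g n ^ s ≤ q * gTail g s (2 * n) * (1 + q) :=
    hgn.trans (mul_le_mul h2n hpow h2q.le (by positivity))
  have h6 : gTail g s n ≤ (1 + q * (1 + q)) * gTail g s (2 * n) := by linarith
  calc (1 - q) * gTail g s n ≤ (1 - q) * ((1 + q * (1 + q)) * gTail g s (2 * n)) := by
        have : 0 ≤ 1 - q := by linarith
        gcongr
    _ = gTail g s (2 * n) - q ^ 3 * gTail g s (2 * n) := by ring
    _ ≤ _ := by
        have : 0 ≤ q ^ 3 * gTail g s (2 * n) := by positivity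
        linarith

end Growth

section Conversion

variable {ψ : ℝ → ℝ} {s s' : ℝ}

theorem gFun_rpow_div (hs : 1 < s) (hss' : 1 / s + 1 / s' = 1) {x : ℝ} (hx : 0 < x)
    (hψ : 0 ≤ ψ x) : gFun ψ s' x ^ s / x = ψ x ^ s * x ^ (s - 2) := by
  have hs0 : s ≠ 0 := by linarith
  rw [gFun, Real.mul_rpow hψ (by positivity), ← Real.rpow_mul hx.le,
    show 1 / s' * s = s - 2 + 1 by rw [eq_sub_of_add_eq' hss']; field_simp; ring,
    Real.rpow_add_one hx.ne']
  field_simp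

theorem tailSum_eq_gTail (hs : 1 < s) (hss' : 1 / s + 1 / s' = 1) (hψ : ψ ∈ frakM) {n : ℕ}
    (hn : 1 ≤ n) : tailSum ψ s n = gTail (gFun ψ s') s n := by
  refine tsum_congr fun j => ?_
  have h1 : (1 : ℝ) ≤ ((n + j : ℕ) : ℝ) := one_le_cast (by omega)
  rw [gFun_rpow_div hs hss' (by linarith) (hψ.1 _ h1).le]

theorem summable_gFun (hs : 1 < s) (hss' : 1 / s + 1 / s' = 1) (hψ : ψ ∈ frakM)
    (hsum : Summable fun j : ℕ => ψ ((j + 1 : ℕ) : ℝ) ^ s * ((j + 1 : ℕ) : ℝ) ^ (s - 2)) :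
    Summable fun k : ℕ => gFun ψ s' k ^ s / (k : ℝ) := by
  refine (summable_nat_add_iff 1).1 (hsum.congr fun j => ?_)
  have h1 : (1 : ℝ) ≤ ((j + 1 : ℕ) : ℝ) := one_le_cast (by omega)
  rw [gFun_rpow_div hs hss' (by linarith) (hψ.1 _ h1).le]

end Conversion

/-! ### Norms of the two cosine polynomials used -/

section Polynomials

variable {ψ : ℝ → ℝ} {s s' : ℝ}

/-- Every section of `∑_{k ≥ n} ψ(k) cos (k x - θ)` has `L_s` norm at most a multiple of the tail
sum. -/
theorem pnorm_cosPoly_psi_le (hs : 1 < s) (hss' : 1 / s + 1 / s' = 1) (hψ : ψ ∈ frakM)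
    (hS : Summable fun k : ℕ => gFun ψ s' k ^ s / (k : ℝ)) (hg : gFun ψ s' ∈ frakM₀)
    (hα : s < alphaInf (gFun ψ s') 1) {n : ℕ} (hn : 1 ≤ n) (M : ℕ) (θ : ℝ) :
    pnorm (cosPoly n M (fun k => ψ k) θ) (ENNReal.ofReal s) ≤
      ENNReal.ofReal (xi s *
        ((1 + s / alphaInf (gFun ψ s') 1) * gTail (gFun ψ s') s n) ^ (1 / s)) := by
  have hψ0 : ∀ k : ℕ, n ≤ k → 0 ≤ ψ k := fun k hk => (hψ.1 k (one_le_cast (hn.trans hk))).le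
  have hanti : AntitoneOn (fun k : ℕ => ψ k) (Ici n) := fun i hi j hj hij =>
    antitoneOn_of_mem_frakM hψ (one_le_cast (hn.trans hi)) (one_le_cast (hn.trans hj))
      (Nat.cast_le.2 hij)
  have hterm : ∀ k : ℕ, n ≤ k → ψ k ^ s * (k : ℝ) ^ (s - 2) = gFun ψ s' k ^ s / k := fun k hk =>
    (gFun_rpow_div hs hss' (by linarith [one_le_cast (hn.trans hk)]) (hψ0 k hk)).symm
  have hn0 : (0 : ℝ) < n := by linarith [one_le_cast hn]
  have hB : ψ n ^ s * (n : ℝ) ^ (s - 1) ≤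
      s / alphaInf (gFun ψ s') 1 * gTail (gFun ψ s') s n := by
    refine le_trans (le_of_eq ?_) (rpow_le_mul_gTail hg hs hα hS hn)
    have h := hterm n le_rfl
    rw [eq_div_iff hn0.ne', mul_assoc, ← Real.rpow_add_one hn0.ne'] at h
    rw [← h]
    congr 2
    ring
  refine (pnorm_cosPoly_le hs hn hψ0 hanti hB (T := gTail (gFun ψ s') s n) (fun K => ?_) M
    θ).trans (le_of_eq ?_)
  · rw [Finset.sum_congr rfl fun k hk => hterm k (Finset.mem_Ico.1 hk).1]
    exact sum_Ico_le_gTail hg hS hn K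
  · congr 3
    ring

/-- The coefficients `g(k) ^ (s - 1) k ^ (-1 / s) = ψ(k) ^ (s - 1) k ^ (s - 2)` of the test
polynomial: the extremal choice in Hölder's inequality for `∑ ψ(k) b_k`. -/
noncomputable def testCoef (g : ℝ → ℝ) (s : ℝ) (k : ℕ) : ℝ := g k ^ (s - 1) * (k : ℝ) ^ (-(1 / s))

theorem testCoef_nonneg {g : ℝ → ℝ} (hg : g ∈ frakM) {k : ℕ} (hk : 1 ≤ k) :
    0 ≤ testCoef g s k :=
  mul_nonneg (Real.rpow_nonneg (hg.1 k (one_le_cast hk)).le _) (by positivity)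

theorem testCoef_antitoneOn {g : ℝ → ℝ} (hg : g ∈ frakM) (hs : 1 < s) {n : ℕ} (hn : 1 ≤ n) :
    AntitoneOn (testCoef g s) (Ici n) := by
  intro i hi j hj hij
  have hi1 := one_le_cast (hn.trans hi)
  have hj1 := one_le_cast (hn.trans hj)
  have hij' : (i : ℝ) ≤ j := Nat.cast_le.2 hij
  have h1 : g j ≤ g i := antitoneOn_of_mem_frakM hg hi1 hj1 hij'
  have h2 := (hg.1 j hj1).le
  refine mul_le_mul (Real.rpow_le_rpow h2 h1 (by linarith)) ?_ (by positivity)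
    (Real.rpow_nonneg (h2.trans h1) _)
  have : 0 < 1 / s := by positivity
  exact Real.rpow_le_rpow_of_nonpos (by linarith) hij' (by linarith)

theorem psi_mul_testCoef (hss' : 1 / s + 1 / s' = 1)
    (hg : gFun ψ s' ∈ frakM₀) {k : ℕ} (hk : 1 ≤ k) :
    ψ k * testCoef (gFun ψ s') s k = gFun ψ s' k ^ s / k := by
  have hk0 : (0 : ℝ) < k := by linarith [one_le_cast hk]
  have hgk := hg.1.1 k (one_le_cast hk)
  have h1 : ψ k = gFun ψ s' k * (k : ℝ) ^ (-(1 / s')) := by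
    rw [gFun, mul_assoc, ← Real.rpow_add hk0, add_neg_cancel, Real.rpow_zero, mul_one]
  have h2 : gFun ψ s' k ^ s = gFun ψ s' k ^ (s - 1) * gFun ψ s' k := by
    rw [← Real.rpow_add_one hgk.ne']
    congr 1
    ring
  have h3 : (k : ℝ) ^ (-(1 / s')) * (k : ℝ) ^ (-(1 / s)) = (k : ℝ)⁻¹ := by
    rw [← Real.rpow_add hk0, show -(1 / s') + -(1 / s) = -1 by linarith, Real.rpow_neg_one]
  calc ψ k * testCoef (gFun ψ s') s k
      = gFun ψ s' k * (k : ℝ) ^ (-(1 / s')) * testCoef (gFun ψ s') s k := by rw [← h1]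
    _ = gFun ψ s' k ^ (s - 1) * gFun ψ s' k *
          ((k : ℝ) ^ (-(1 / s')) * (k : ℝ) ^ (-(1 / s))) := by
        rw [testCoef]
        ring
    _ = _ := by rw [h3, ← h2, div_eq_mul_inv]

theorem pnorm_cosPoly_testCoef_le {g : ℝ → ℝ} (hs : 1 < s) (hs' : 1 < s')
    (hss' : 1 / s + 1 / s' = 1) (hS : Summable fun k : ℕ => g k ^ s / (k : ℝ)) (hg : g ∈ frakM₀)
    (hα : s < alphaInf g 1) {n : ℕ} (hn : 1 ≤ n) (M : ℕ) (θ : ℝ) :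
    pnorm (cosPoly n M (testCoef g s) θ) (ENNReal.ofReal s') ≤
      ENNReal.ofReal (xi s' * ((1 + s / alphaInf g 1) * gTail g s n) ^ (1 / s')) := by
  have hs0 : s ≠ 0 := by linarith
  have hs'0 : s' ≠ 0 := by linarith
  have hmul : s * s' = s + s' := by
    field_simp at hss'
    linarith
  have hpow : ∀ k : ℕ, n ≤ k → testCoef g s k ^ s' = g k ^ s * (k : ℝ) ^ (1 - s') := by
    intro k hk
    have hk1 := one_le_cast (hn.trans hk)
    have hgk := (hg.1.1 k hk1).le
    rw [testCoef, Real.mul_rpow (Real.rpow_nonneg hgk _) (by positivity), ← Real.rpow_mul hgk,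
      ← Real.rpow_mul (by positivity)]
    congr 2
    · linarith
    · field_simp
      linarith
  have hB : testCoef g s n ^ s' * (n : ℝ) ^ (s' - 1) ≤ s / alphaInf g 1 * gTail g s n := by
    refine le_trans (le_of_eq ?_) (rpow_le_mul_gTail hg hs hα hS hn)
    have hn0 : (0 : ℝ) < n := by linarith [one_le_cast hn]
    rw [hpow n le_rfl, mul_assoc, ← Real.rpow_add hn0, show 1 - s' + (s' - 1) = 0 by ring,
      Real.rpow_zero, mul_one]
  refine (pnorm_cosPoly_le hs' hn (fun k hk => testCoef_nonneg hg.1 (hn.trans hk))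
    (testCoef_antitoneOn hg.1 hs hn) hB (T := gTail g s n) (fun K => ?_) M
    θ).trans (le_of_eq ?_)
  · refine le_trans (Finset.sum_le_sum fun k hk => le_of_eq ?_) (sum_Ico_le_gTail hg hS hn K)
    have hnk := (Finset.mem_Ico.1 hk).1
    have hk0 : (0 : ℝ) < k := by linarith [one_le_cast (hn.trans hnk)]
    rw [hpow k hnk, mul_assoc, ← Real.rpow_add hk0, show 1 - s' + (s' - 2) = -1 by ring,
      Real.rpow_neg_one, div_eq_mul_inv]
  · congr 3
    ring

end Polynomials

/-! ### Integration over a period and uniqueness of Fourier coefficients -/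

instance : IsFiniteMeasure periodMeasure := by
  unfold periodMeasure
  infer_instance

theorem integral_periodMeasure (F : ℝ → ℂ) :
    ∫ x, F x ∂periodMeasure = ∫ x in (0)..(2 * π), F x := by
  rw [intervalIntegral.integral_of_le (by have := Real.pi_pos; positivity),
    ← integral_Ico_eq_integral_Ioc, periodMeasure]

theorem integrable_periodMeasure_of_continuous {E : Type*} [NormedAddCommGroup E] {F : ℝ → E}
    (hF : Continuous F) : Integrable F periodMeasure :=
  ((hF.integrableOn_Icc (a := 0) (b := 2 * π)).mono_set Ico_subset_Icc_self)

theorem integral_exp_periodMeasure (k : ℤ) :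
    ∫ x, Complex.exp (Complex.I * k * x) ∂periodMeasure = if k = 0 then 2 * (π : ℂ) else 0 := by
  rw [integral_periodMeasure]
  split_ifs with hk
  · simp [hk]
  · have hc : Complex.I * (k : ℂ) ≠ 0 := mul_ne_zero Complex.I_ne_zero (by exact_mod_cast hk)
    rw [integral_exp_mul_complex hc]
    have : Complex.I * k * ((2 * π : ℝ) : ℂ) = k * (2 * π * Complex.I) := by
      push_cast
      ring
    rw [this, Complex.exp_int_mul_two_pi_mul_I]
    simp

theorem exp_periodic (k : ℤ) :
    Function.Periodic (fun x : ℝ => Complex.exp (Complex.I * k * x)) (2 * π) := by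
  intro x
  simp only
  rw [show Complex.I * k * ((x + 2 * π : ℝ) : ℂ) = Complex.I * k * x + k * (2 * π * Complex.I) by
    push_cast; ring, Complex.exp_add, Complex.exp_int_mul_two_pi_mul_I, mul_one]

theorem norm_exp_I_mul_int (k : ℤ) (x : ℝ) : ‖Complex.exp (Complex.I * k * x)‖ = 1 := by
  rw [show Complex.I * k * x = ((k * x : ℝ) : ℂ) * Complex.I by push_cast; ring,
    Complex.norm_exp_ofReal_mul_I]

/-- For a periodic function the coefficients may be computed over `[0, 2π)`. -/
theorem coef_eq_integral {f : ℝ → ℝ} (hf : Function.Periodic f (2 * π)) (k : ℤ) :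
    coef f k = (1 / (2 * π) : ℂ) *
      ∫ t, (f t : ℂ) * Complex.exp (Complex.I * (-k : ℤ) * t) ∂periodMeasure := by
  rw [coef_eq, integral_periodMeasure]
  have hper : Function.Periodic
      (fun t : ℝ => (f t : ℂ) * Complex.exp (Complex.I * (-k : ℤ) * t)) (2 * π) := by
    intro t
    have h1 := exp_periodic (-k) t
    simp only at h1 ⊢
    rw [h1, hf t]
  have h := hper.intervalIntegral_add_eq (-π) 0
  rw [show -π + 2 * π = π by ring, zero_add] at h
  rw [← h]
  congr 1
  refine intervalIntegral.integral_congr fun t _ => ?_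
  congr 2
  push_cast
  ring

/-- An integrable function all of whose Fourier coefficients vanish is zero almost everywhere:
trigonometric polynomials are dense in the continuous functions on the circle. -/
theorem ae_eq_zero_of_forall_integral_exp_eq_zero {u : ℝ → ℂ} (hu : Integrable u periodMeasure)
    (h : ∀ k : ℤ, ∫ x, Complex.exp (Complex.I * k * x) * u x ∂periodMeasure = 0) :
    u =ᵐ[periodMeasure] 0 := by
  have h2π : 0 < 2 * π := by have := Real.pi_pos; positivity
  have : Fact (0 < 2 * π) := ⟨h2π⟩
  have hint : ∀ F : C(AddCircle (2 * π), ℂ),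
      Integrable (fun x : ℝ => F (x : AddCircle (2 * π)) * u x) periodMeasure := fun F =>
    hu.bdd_mul (c := ‖F‖)
      (F.continuous.comp (AddCircle.continuous_mk' (2 * π))).aestronglyMeasurable
      (Eventually.of_forall fun x => F.norm_coe_le_norm _)
  have hspan : ∀ P ∈ Submodule.span ℂ (range (fourier (T := 2 * π))),
      ∫ x : ℝ, P (x : AddCircle (2 * π)) * u x ∂periodMeasure = 0 := by
    intro P hP
    induction hP using Submodule.span_induction with
    | mem P hP =>
      obtain ⟨k, rfl⟩ := hP
      rw [← h k]
      refine integral_congr_ae (Eventually.of_forall fun x => ?_)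
      simp only [fourier_coe_apply]
      congr 2
      push_cast
      field_simp
    | zero => simp
    | add P Q _ _ hP hQ =>
      simp only [ContinuousMap.add_apply, add_mul]
      rw [integral_add (hint P) (hint Q), hP, hQ, add_zero]
    | smul c P _ hP =>
      simp only [ContinuousMap.smul_apply, smul_eq_mul, mul_assoc]
      rw [integral_const_mul, hP, mul_zero]
  have hall : ∀ F : C(AddCircle (2 * π), ℂ),
      ∫ x : ℝ, F (x : AddCircle (2 * π)) * u x ∂periodMeasure = 0 := by
    intro F
    have hF : F ∈ closure (Submodule.span ℂ (range (fourier (T := 2 * π))) :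
        Set C(AddCircle (2 * π), ℂ)) := by
      rw [← Submodule.topologicalClosure_coe, span_fourier_closure_eq_top]
      trivial
    have hle : ∀ ε : ℝ, 0 < ε → ‖∫ x : ℝ, F (x : AddCircle (2 * π)) * u x ∂periodMeasure‖ ≤
        ε * ∫ x, ‖u x‖ ∂periodMeasure := by
      intro ε hε
      obtain ⟨P, hP, hFP⟩ := Metric.mem_closure_iff.1 hF ε hε
      rw [← sub_zero (∫ x : ℝ, F (x : AddCircle (2 * π)) * u x ∂periodMeasure), ← hspan P hP,
        ← integral_sub (hint F) (hint P), ← integral_const_mul]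
      refine norm_integral_le_of_norm_le (hu.norm.const_mul ε) (Eventually.of_forall fun x => ?_)
      rw [← sub_mul, norm_mul]
      gcongr
      rw [← dist_eq_norm]
      exact (ContinuousMap.dist_apply_le_dist _).trans hFP.le
    have hlim : Tendsto (fun ε : ℝ => ε * ∫ x, ‖u x‖ ∂periodMeasure) (𝓝[>] 0) (𝓝 0) := by
      have : Tendsto (fun ε : ℝ => ε * ∫ x, ‖u x‖ ∂periodMeasure) (𝓝 0)
          (𝓝 (0 * ∫ x, ‖u x‖ ∂periodMeasure)) := tendsto_id.mul_const _
      rw [zero_mul] at this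
      exact this.mono_left nhdsWithin_le_nhds
    exact norm_le_zero_iff.1 (ge_of_tendsto hlim
      (eventually_mem_nhdsWithin.mono fun ε hε => hle ε hε))
  have hloc : LocallyIntegrableOn u (Ioo 0 (2 * π)) volume :=
    IntegrableOn.locallyIntegrableOn (IntegrableOn.mono_set hu Ioo_subset_Ico_self)
  have hae := isOpen_Ioo.ae_eq_zero_of_integral_contDiff_smul_eq_zero hloc ?_
  · change ∀ᵐ x ∂(volume.restrict (Ico 0 (2 * π))), u x = 0
    rw [← restrict_Ioo_eq_restrict_Ico]
    exact (ae_restrict_iff' measurableSet_Ioo).2 hae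
  · intro g hg _ hsupp
    have hg0 : ∀ x, x ∉ Ioo 0 (2 * π) → g x = 0 := fun x hx =>
      image_eq_zero_of_notMem_tsupport fun hx' => hx (hsupp hx')
    have hcont : Continuous (AddCircle.liftIco (2 * π) 0 fun x => (g x : ℂ)) := by
      refine AddCircle.liftIco_continuous ?_ ?_
      · simp [hg0 0 (by simp), hg0 (2 * π) (by simp)]
      · exact (Complex.continuous_ofReal.comp hg.continuous).continuousOn
    have h1 := hall ⟨_, hcont⟩
    rw [← setIntegral_eq_integral_of_forall_compl_eq_zero (s := Ico 0 (2 * π))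
      (fun x hx => by rw [hg0 x fun hx' => hx (Ioo_subset_Ico_self hx'), zero_smul])]
    rw [← h1, periodMeasure]
    refine setIntegral_congr_fun measurableSet_Ico fun x hx => ?_
    simp only [ContinuousMap.coe_mk]
    rw [AddCircle.liftIco_coe_apply (by simpa using hx), Complex.real_smul]

/-! ### Convolution with a kernel and differences of partial sums -/

theorem lintegral_periodMeasure_comp_sub {F : ℝ → ℝ≥0∞} (hF : Measurable F)
    (hper : Function.Periodic F (2 * π)) (t : ℝ) :
    ∫⁻ x, F (x - t) ∂periodMeasure = ∫⁻ x, F x ∂periodMeasure := by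
  have h2π : 0 < 2 * π := by have := Real.pi_pos; positivity
  have hpre : (fun x => x - t) ⁻¹' Ioc (-t) (-t + 2 * π) = Ioc 0 (0 + 2 * π) := by
    ext x
    simp only [mem_preimage, mem_Ioc]
    constructor <;> rintro ⟨h1, h2⟩ <;> constructor <;> linarith
  have h := (measurePreserving_sub_right volume t).setLIntegral_comp_preimage
    (measurableSet_Ioc (a := -t) (b := -t + 2 * π)) hF
  rw [hpre] at h
  simp only [periodMeasure, restrict_Ico_eq_restrict_Ioc]
  rw [zero_add] at h
  have hfd := (isAddFundamentalDomain_Ioc h2π (-t) volume).setLIntegral_eq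
    (isAddFundamentalDomain_Ioc h2π 0 volume) F hper.map_vadd_zmultiples
  rw [h, hfd, zero_add]

/-- Young's inequality `‖φ * P‖_s ≤ ‖φ‖₁ ‖P‖_s` over a period, for a continuous kernel `P` and
`‖φ‖₁ ≤ 1`. -/
theorem pnorm_convolution_le {φ : ℝ → ℝ} (hφ : MemLp φ 1 periodMeasure) (hφ1 : pnorm φ 1 ≤ 1)
    {P : ℝ → ℝ} (hP : Continuous P) (hper : Function.Periodic P (2 * π)) {s : ℝ} (hs : 1 < s) :
    pnorm (fun x => ∫ t, φ t * P (x - t) ∂periodMeasure) (ENNReal.ofReal s) ≤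
      pnorm P (ENNReal.ofReal s) := by
  have hs0 : 0 < s := by linarith
  have h0 : ENNReal.ofReal s ≠ 0 := by simpa using hs0
  have hmass : ∫⁻ t, ‖φ t‖ₑ ∂periodMeasure ≤ 1 := by
    rw [← eLpNorm_one_eq_lintegral_enorm]
    exact hφ1
  have hφm : AEMeasurable (fun t => ‖φ t‖ₑ) periodMeasure := hφ.aestronglyMeasurable.enorm
  have hpq := (Real.HolderConjugate.conjExponent hs).symm
  set p := Real.conjExponent s with hp
  have hsum : 1 / p + 1 / s = 1 := by
    have := hpq.inv_add_inv_eq_one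
    simpa [one_div] using this
  have hp0 : 0 < p := hpq.pos
  -- Hölder's inequality with respect to the measure `|φ(t)| dt`, whose mass is at most one.
  have hpt : ∀ x, ‖∫ t, φ t * P (x - t) ∂periodMeasure‖ₑ ^ s ≤
      ∫⁻ t, ‖φ t‖ₑ * ‖P (x - t)‖ₑ ^ s ∂periodMeasure := by
    intro x
    have hPm : Measurable fun t => ‖P (x - t)‖ₑ := by
      have : Measurable fun t => P (x - t) := (hP.comp (by fun_prop)).measurable
      exact this.enorm
    have h1 : ‖∫ t, φ t * P (x - t) ∂periodMeasure‖ₑ ≤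
        ∫⁻ t, ‖φ t‖ₑ ^ (1 / p) * (‖φ t‖ₑ ^ (1 / s) * ‖P (x - t)‖ₑ) ∂periodMeasure := by
      refine (enorm_integral_le_lintegral_enorm _).trans (le_of_eq (lintegral_congr fun t => ?_))
      rw [enorm_mul, ← mul_assoc, ← ENNReal.rpow_add_of_nonneg _ _ (by positivity) (by positivity),
        hsum, ENNReal.rpow_one]
    have h2 := ENNReal.lintegral_mul_le_Lp_mul_Lq periodMeasure hpq
      (f := fun t => ‖φ t‖ₑ ^ (1 / p)) (g := fun t => ‖φ t‖ₑ ^ (1 / s) * ‖P (x - t)‖ₑ)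
      (hφm.pow_const _) ((hφm.pow_const _).mul hPm.aemeasurable)
    have h3 : ∀ t, (‖φ t‖ₑ ^ (1 / p)) ^ p = ‖φ t‖ₑ := fun t => by
      rw [← ENNReal.rpow_mul, one_div_mul_cancel hp0.ne', ENNReal.rpow_one]
    have h4 : ∀ t, (‖φ t‖ₑ ^ (1 / s) * ‖P (x - t)‖ₑ) ^ s = ‖φ t‖ₑ * ‖P (x - t)‖ₑ ^ s := fun t => by
      rw [ENNReal.mul_rpow_of_nonneg _ _ hs0.le, ← ENNReal.rpow_mul, one_div_mul_cancel hs0.ne',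
        ENNReal.rpow_one]
    simp only [Pi.mul_apply, h3, h4] at h2
    have h5 : (∫⁻ t, ‖φ t‖ₑ ∂periodMeasure) ^ (1 / p) ≤ 1 :=
      ENNReal.rpow_le_one hmass (by positivity)
    have h6 := h1.trans (h2.trans (mul_le_of_le_one_left zero_le h5))
    calc _ ≤ ((∫⁻ t, ‖φ t‖ₑ * ‖P (x - t)‖ₑ ^ s ∂periodMeasure) ^ (1 / s)) ^ s :=
          ENNReal.rpow_le_rpow h6 hs0.le
      _ = _ := by rw [← ENNReal.rpow_mul, one_div_mul_cancel hs0.ne', ENNReal.rpow_one]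
  have hPs : Measurable fun x => ‖P x‖ₑ ^ s := hP.measurable.enorm.pow_const s
  rw [pnorm, pnorm, eLpNorm_eq_lintegral_rpow_enorm_toReal h0 ENNReal.ofReal_ne_top,
    eLpNorm_eq_lintegral_rpow_enorm_toReal h0 ENNReal.ofReal_ne_top,
    ENNReal.toReal_ofReal hs0.le]
  refine ENNReal.rpow_le_rpow ((lintegral_mono hpt).trans ?_) (by positivity)
  rw [lintegral_lintegral_swap]
  · calc _ = ∫⁻ t, ‖φ t‖ₑ * ∫⁻ x, ‖P x‖ₑ ^ s ∂periodMeasure ∂periodMeasure := by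
          refine lintegral_congr fun t => ?_
          have hm : Measurable fun x => ‖P (x - t)‖ₑ ^ s := hPs.comp (measurable_sub_const t)
          rw [lintegral_const_mul _ hm, lintegral_periodMeasure_comp_sub hPs (fun x => by simp only [hper x]) t]
      _ ≤ _ := by
          rw [lintegral_mul_const'' _ hφm]
          exact mul_le_of_le_one_left zero_le hmass
  · refine AEMeasurable.mul ?_ ?_
    · exact hφ.aestronglyMeasurable.comp_snd.enorm
    · exact (hPs.comp (measurable_fst.sub measurable_snd)).aemeasurable

theorem partialSum_Ioo_sub {n M : ℕ} (hn : 1 ≤ n) (hM : n ≤ M) (f : ℝ → ℝ) (x : ℝ) :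
    partialSum (Finset.Ioo (-M : ℤ) M) f x - partialSum (Finset.Ioo (-n : ℤ) n) f x =
      ∑ k ∈ Finset.Ico n M, (coef f k * Complex.exp (Complex.I * (k : ℤ) * x) +
        coef f (-k) * Complex.exp (Complex.I * (-k : ℤ) * x)) := by
  induction M, hM using Nat.le_induction with
  | base => simp
  | succ M hM ih =>
    have hset : Finset.Ioo (-(M + 1 : ℕ) : ℤ) (M + 1 : ℕ) =
        insert (M : ℤ) (insert (-M : ℤ) (Finset.Ioo (-M : ℤ) M)) := by
      ext k
      simp only [Finset.mem_insert, Finset.mem_Ioo]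
      omega
    rw [Finset.sum_Ico_succ_top hM, ← ih, hset, partialSum, Finset.sum_insert, Finset.sum_insert]
    · simp only [partialSum]
      ring
    · simp
    · simp only [Finset.mem_insert, Finset.mem_Ioo]
      omega

section Derivative

variable {ψ : ℕ → ℝ} {β : ℝ} {f φ : ℝ → ℝ}

theorem coef_eq_of_deriv (h : IsPsiBetaDeriv ψ β f φ) {k : ℤ} (hk : k ≠ 0)
    (hψ : ψ k.natAbs ≠ 0) :
    coef f k = ψ k.natAbs * Complex.exp (-(Complex.I * ((β * π / 2 * (k.sign : ℝ) : ℝ) : ℂ))) *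
      coef φ k := by
  rw [h.2.2 k hk, Complex.exp_neg]
  have := Complex.exp_ne_zero (Complex.I * ((β * π / 2 * (k.sign : ℝ) : ℝ) : ℂ))
  have hψ' : (ψ k.natAbs : ℂ) ≠ 0 := by exact_mod_cast hψ
  field_simp

theorem coef_pair_eq (h : IsPsiBetaDeriv ψ β f φ) {k : ℕ} (hk : 1 ≤ k) (hψ : ψ k ≠ 0) (x : ℝ) :
    coef f k * Complex.exp (Complex.I * (k : ℤ) * x) +
        coef f (-k) * Complex.exp (Complex.I * (-k : ℤ) * x) =
      ((1 / π * ∫ t, φ t * (ψ k * Real.cos (k * (x - t) - β * π / 2)) ∂periodMeasure : ℝ) : ℂ) := by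
  have hφi : Integrable (fun t => (φ t : ℂ)) periodMeasure :=
    (memLp_one_iff_integrable.1 h.1.2).ofReal
  have hexp : ∀ m : ℤ,
      Integrable (fun t : ℝ => (φ t : ℂ) * Complex.exp (Complex.I * m * t)) periodMeasure :=
    fun m => hφi.mul_bdd (c := 1)
      (by fun_prop : Continuous fun t : ℝ => Complex.exp (Complex.I * m * t)).aestronglyMeasurable
      (Eventually.of_forall fun t => (norm_exp_I_mul_int m t).le)
  have hk0 : (0 : ℤ) < k := by exact_mod_cast hk
  rw [coef_eq_of_deriv h hk0.ne' (by simpa using hψ),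
    coef_eq_of_deriv h (neg_ne_zero.2 hk0.ne') (by simpa using hψ), coef_eq_integral h.1.1,
    coef_eq_integral h.1.1]
  simp only [Int.natAbs_neg, Int.natAbs_natCast, Int.sign_neg, Int.sign_eq_one_of_pos hk0]
  set θ : ℝ := β * π / 2 with hθ
  calc _ = (1 / (2 * π) : ℂ) * ((∫ t, (φ t : ℂ) * Complex.exp (Complex.I * (-k : ℤ) * t) *
          (ψ k * Complex.exp (-(Complex.I * θ)) * Complex.exp (Complex.I * (k : ℤ) * x))
            ∂periodMeasure) +
        ∫ t, (φ t : ℂ) * Complex.exp (Complex.I * (- -k : ℤ) * t) *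
          (ψ k * Complex.exp (Complex.I * θ) * Complex.exp (Complex.I * (-k : ℤ) * x))
            ∂periodMeasure) := by
        rw [integral_mul_const, integral_mul_const]
        push_cast
        simp only [mul_one, mul_neg, neg_neg]
        ring
    _ = (1 / (2 * π) : ℂ) * ∫ t, 2 * ((φ t * (ψ k * Real.cos (k * (x - t) - θ)) : ℝ) : ℂ)
          ∂periodMeasure := by
        rw [← integral_add ((hexp _).mul_const _) ((hexp _).mul_const _)]
        congr 1
        refine integral_congr_ae (Eventually.of_forall fun t => ?_)
        have e1 : Complex.exp (Complex.I * (-k : ℤ) * t) * Complex.exp (-(Complex.I * θ)) *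
            Complex.exp (Complex.I * (k : ℤ) * x) =
              Complex.exp (((k * (x - t) - θ : ℝ) : ℂ) * Complex.I) := by
          rw [← Complex.exp_add, ← Complex.exp_add]
          congr 1
          push_cast
          ring
        have e2 : Complex.exp (Complex.I * (- -k : ℤ) * t) * Complex.exp (Complex.I * θ) *
            Complex.exp (Complex.I * (-k : ℤ) * x) =
              Complex.exp (-((k * (x - t) - θ : ℝ) : ℂ) * Complex.I) := by
          rw [← Complex.exp_add, ← Complex.exp_add]
          congr 1
          push_cast
          ring
        have e3 := Complex.two_cos (((k * (x - t) - θ : ℝ) : ℂ))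
        rw [← e1, ← e2, ← Complex.ofReal_cos] at e3
        simp only
        rw [Complex.ofReal_mul (φ t), Complex.ofReal_mul (ψ k)]
        linear_combination (-(φ t : ℂ) * ψ k) * e3
    _ = _ := by
        rw [integral_const_mul, integral_complex_ofReal]
        generalize ∫ t, φ t * (ψ k * Real.cos (k * (x - t) - θ)) ∂periodMeasure = J
        push_cast
        have : (π : ℂ) ≠ 0 := by exact_mod_cast Real.pi_ne_zero
        field_simp

/-- The difference of two symmetric partial sums of `f` is a convolution of its
`(ψ, β)`-derivative with a section of the kernel `∑ ψ(k) cos (k t - β π / 2)`. -/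
theorem partialSum_sub_eq_convolution (h : IsPsiBetaDeriv ψ β f φ) {n M : ℕ} (hn : 1 ≤ n)
    (hM : n ≤ M) (hψ : ∀ k, n ≤ k → ψ k ≠ 0) (x : ℝ) :
    partialSum (Finset.Ioo (-M : ℤ) M) f x - partialSum (Finset.Ioo (-n : ℤ) n) f x =
      ((1 / π * ∫ t, φ t * cosPoly n M ψ (β * π / 2) (x - t) ∂periodMeasure : ℝ) : ℂ) := by
  rw [partialSum_Ioo_sub hn hM, Finset.sum_congr rfl fun k hk =>
    coef_pair_eq h (hn.trans (Finset.mem_Ico.1 hk).1) (hψ k (Finset.mem_Ico.1 hk).1) x,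
    ← Complex.ofReal_sum, ← Finset.mul_sum, ← integral_finsetSum]
  · simp only [cosPoly, Finset.mul_sum]
  · intro k _
    have hφi : Integrable φ periodMeasure := memLp_one_iff_integrable.1 h.1.2
    refine hφi.mul_bdd (c := |ψ k|) (Continuous.aestronglyMeasurable (by fun_prop))
      (Eventually.of_forall fun t => ?_)
    rw [norm_mul, Real.norm_eq_abs, Real.norm_eq_abs]
    exact mul_le_of_le_one_right (abs_nonneg _) (Real.abs_cos_le_one _)

end Derivative

/-! ### The upper bound -/

theorem continuous_partialSum (γ : Finset ℤ) (f : ℝ → ℝ) : Continuous (partialSum γ f) := by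
  unfold partialSum
  fun_prop

theorem memLp_of_continuous {E : Type*} [NormedAddCommGroup E] [SecondCountableTopology E]
    {F : ℝ → E} (hF : Continuous F) (p : ℝ≥0∞) : MemLp F p periodMeasure := by
  obtain ⟨C, hC⟩ := (isCompact_Icc (a := 0) (b := 2 * π)).exists_bound_of_continuousOn
    hF.continuousOn
  refine MemLp.of_bound hF.aestronglyMeasurable C ?_
  exact (ae_restrict_iff' measurableSet_Ico).2
    (Eventually.of_forall fun x hx => hC x (Ico_subset_Icc_self hx))

theorem integral_exp_mul_partialSum (k : ℤ) (γ : Finset ℤ) (f : ℝ → ℝ) :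
    ∫ x, Complex.exp (Complex.I * k * x) * partialSum γ f x ∂periodMeasure =
      if -k ∈ γ then 2 * (π : ℂ) * coef f (-k) else 0 := by
  have h1 : ∀ x : ℝ, Complex.exp (Complex.I * k * x) * partialSum γ f x =
      ∑ j ∈ γ, coef f j * Complex.exp (Complex.I * (k + j : ℤ) * x) := by
    intro x
    rw [partialSum, Finset.mul_sum]
    refine Finset.sum_congr rfl fun j _ => ?_
    rw [mul_left_comm, ← Complex.exp_add]
    congr 2
    push_cast
    ring
  simp only [h1]
  rw [integral_finsetSum _ fun j _ => integrable_periodMeasure_of_continuous (by fun_prop)]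
  simp only [integral_const_mul, integral_exp_periodMeasure]
  have h2 : ∀ j : ℤ, k + j = 0 ↔ j = -k := fun j => by omega
  simp only [h2, mul_ite, mul_zero, Finset.sum_ite_eq']
  split_ifs <;> ring

theorem integral_exp_mul_eq_coef {f : ℝ → ℝ} (hf : Function.Periodic f (2 * π)) (k : ℤ) :
    ∫ x, Complex.exp (Complex.I * k * x) * (f x : ℂ) ∂periodMeasure =
      2 * (π : ℂ) * coef f (-k) := by
  rw [coef_eq_integral hf, neg_neg, ← mul_assoc, mul_one_div_cancel (by simp), one_mul]
  simp only [mul_comm]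

/-- If the symmetric partial sums of `f` form a Cauchy sequence in `L_s` with rate `E`, then they
converge to `f` with the same rate: the `L_s` limit has the Fourier coefficients of `f`. -/
theorem pnorm_sub_partialSum_le {f : ℝ → ℝ} (hf : MemL f 1) {s : ℝ} (hs : 1 < s) {E : ℕ → ℝ≥0∞}
    (hE : Tendsto E atTop (𝓝 0))
    (h : ∀ n M : ℕ, 1 ≤ n → n ≤ M →
      pnorm (fun x => partialSum (Finset.Ioo (-M : ℤ) M) f x -
        partialSum (Finset.Ioo (-n : ℤ) n) f x) (ENNReal.ofReal s) ≤ E n) {n : ℕ} (hn : 1 ≤ n) :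
    pnorm (fun x => (f x : ℂ) - partialSum (Finset.Ioo (-n : ℤ) n) f x) (ENNReal.ofReal s) ≤
      E n := by
  have hp1 : 1 ≤ ENNReal.ofReal s := ENNReal.one_le_ofReal.2 hs.le
  have : Fact (1 ≤ ENNReal.ofReal s) := ⟨hp1⟩
  set S : ℕ → ℝ → ℂ := fun m => partialSum (Finset.Ioo (-m : ℤ) m) f with hS
  have hSm : ∀ m, MemLp (S m) (ENNReal.ofReal s) periodMeasure := fun m =>
    memLp_of_continuous (continuous_partialSum _ f) _
  have hcauchy : CauchySeq fun m => (hSm m).toLp (S m) := by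
    refine EMetric.cauchySeq_iff'.2 fun ε hε => ?_
    obtain ⟨N, hN1, hN⟩ := ((eventually_ge_atTop 1).and (hE.eventually_lt_const hε)).exists
    refine ⟨N, fun M hM => ?_⟩
    rw [Lp.edist_toLp_toLp]
    exact (h N M hN1 hM).trans_lt hN
  obtain ⟨w, hv⟩ := cauchySeq_tendsto_of_complete hcauchy
  set v : ℝ → ℂ := ⇑w
  have hv' : Tendsto (fun m => eLpNorm (S m - v) (ENNReal.ofReal s) periodMeasure) atTop
      (𝓝 0) := by
    have h1 := tendsto_iff_edist_tendsto_0.1 hv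
    refine h1.congr fun m => ?_
    rw [Lp.edist_def]
    exact eLpNorm_congr_ae ((hSm m).coeFn_toLp.sub (ae_eq_refl _))
  have hvint : Integrable v periodMeasure := (Lp.memLp w).integrable hp1
  have hfint : Integrable (fun x => (f x : ℂ)) periodMeasure :=
    (memLp_one_iff_integrable.1 hf.2).ofReal
  have hexp : ∀ (k : ℤ) {w : ℝ → ℂ}, Integrable w periodMeasure →
      Integrable (fun x : ℝ => Complex.exp (Complex.I * k * x) * w x) periodMeasure :=
    fun k w hw => hw.bdd_mul (c := 1)
      (by fun_prop : Continuous fun t : ℝ => Complex.exp (Complex.I * k * t)).aestronglyMeasurable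
      (Eventually.of_forall fun t => (norm_exp_I_mul_int k t).le)
  have hcoef : ∀ k : ℤ, ∫ x, Complex.exp (Complex.I * k * x) * v x ∂periodMeasure =
      2 * (π : ℂ) * coef f (-k) := by
    intro k
    have hbound : ∀ m, ‖(∫ x, Complex.exp (Complex.I * k * x) * S m x ∂periodMeasure) -
        ∫ x, Complex.exp (Complex.I * k * x) * v x ∂periodMeasure‖ₑ ≤
          eLpNorm (S m - v) (ENNReal.ofReal s) periodMeasure *
            periodMeasure univ ^ (1 / (1 : ℝ≥0∞).toReal - 1 / (ENNReal.ofReal s).toReal) := by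
      intro m
      have hSi := (hSm m).integrable hp1
      rw [← integral_sub (hexp k hSi) (hexp k hvint)]
      refine le_trans (enorm_integral_le_lintegral_enorm _) ?_
      refine le_trans (le_of_eq ?_) (eLpNorm_le_eLpNorm_mul_rpow_measure_univ hp1
        (hSi.sub hvint).aestronglyMeasurable)
      rw [eLpNorm_one_eq_lintegral_enorm]
      refine lintegral_congr fun x => ?_
      rw [← mul_sub, enorm_mul, ← ofReal_norm (Complex.exp _), norm_exp_I_mul_int,
        ENNReal.ofReal_one, one_mul, Pi.sub_apply]
    have hlim : Tendsto (fun m => ∫ x, Complex.exp (Complex.I * k * x) * S m x ∂periodMeasure)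
        atTop (𝓝 (∫ x, Complex.exp (Complex.I * k * x) * v x ∂periodMeasure)) := by
      refine tendsto_iff_edist_tendsto_0.2 ?_
      simp only [edist_eq_enorm_sub]
      refine tendsto_of_tendsto_of_tendsto_of_le_of_le tendsto_const_nhds ?_
        (fun _ => zero_le) hbound
      have hfin : periodMeasure univ ^
          (1 / (1 : ℝ≥0∞).toReal - 1 / (ENNReal.ofReal s).toReal) ≠ ∞ := by
        refine ENNReal.rpow_ne_top_of_nonneg ?_ (measure_ne_top _ _)
        rw [ENNReal.toReal_one, ENNReal.toReal_ofReal (by linarith), div_one, sub_nonneg]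
        exact (div_le_one (by linarith)).2 hs.le
      simpa using ENNReal.Tendsto.mul_const hv' (Or.inr hfin)
    refine tendsto_nhds_unique hlim (tendsto_const_nhds.congr' ?_)
    filter_upwards [eventually_gt_atTop k.natAbs] with m hm
    rw [hS, integral_exp_mul_partialSum, if_pos]
    rw [Finset.mem_Ioo]
    omega
  have hae : (fun x => v x - (f x : ℂ)) =ᵐ[periodMeasure] 0 := by
    refine ae_eq_zero_of_forall_integral_exp_eq_zero (hvint.sub hfint) fun k => ?_
    simp only [mul_sub]
    rw [integral_sub (hexp k hvint) (hexp k hfint), hcoef, integral_exp_mul_eq_coef hf.1, sub_self]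
  have hlim : Tendsto (fun M => eLpNorm (S M - v) (ENNReal.ofReal s) periodMeasure + E n) atTop
      (𝓝 (0 + E n)) := hv'.add_const (E n)
  rw [zero_add] at hlim
  refine ge_of_tendsto hlim ?_
  filter_upwards [eventually_ge_atTop n] with M hM
  calc pnorm (fun x => (f x : ℂ) - S n x) (ENNReal.ofReal s)
      = eLpNorm ((fun x => v x - S M x) + fun x => S M x - S n x) (ENNReal.ofReal s)
          periodMeasure := by
        refine eLpNorm_congr_ae ?_
        filter_upwards [hae] with x hx
        simp only [Pi.zero_apply, sub_eq_zero] at hx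
        simp only [Pi.add_apply, hx]
        ring
    _ ≤ eLpNorm (fun x => v x - S M x) (ENNReal.ofReal s) periodMeasure +
          eLpNorm (fun x => S M x - S n x) (ENNReal.ofReal s) periodMeasure :=
        eLpNorm_add_le ((Lp.memLp w).sub (hSm M)).aestronglyMeasurable
          ((hSm M).sub (hSm n)).aestronglyMeasurable hp1
    _ ≤ _ := by
        refine add_le_add (le_of_eq ?_) (h n M hn hM)
        exact eLpNorm_sub_comm _ _ _ _

theorem pnorm_ofReal (F : ℝ → ℝ) (p : ℝ≥0∞) : pnorm (fun x => (F x : ℂ)) p = pnorm F p :=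
  eLpNorm_congr_norm_ae (Eventually.of_forall fun x => Complex.norm_real (F x))

section Upper

variable {ψ : ℝ → ℝ} {s s' β : ℝ}

theorem pnorm_partialSum_sub_le (hs : 1 < s) (hss' : 1 / s + 1 / s' = 1) (hψ : ψ ∈ frakM)
    (hS : Summable fun k : ℕ => gFun ψ s' k ^ s / (k : ℝ)) (hg : gFun ψ s' ∈ frakM₀)
    (hα : s < alphaInf (gFun ψ s') 1) {f φ : ℝ → ℝ}
    (hφ : IsPsiBetaDeriv (fun k : ℕ => ψ k) β f φ) (hφ1 : pnorm φ 1 ≤ 1) {n M : ℕ} (hn : 1 ≤ n)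
    (hM : n ≤ M) :
    pnorm (fun x => partialSum (Finset.Ioo (-M : ℤ) M) f x -
        partialSum (Finset.Ioo (-n : ℤ) n) f x) (ENNReal.ofReal s) ≤
      ENNReal.ofReal (1 / π * (xi s *
        ((1 + s / alphaInf (gFun ψ s') 1) * gTail (gFun ψ s') s n) ^ (1 / s))) := by
  have hpos := Real.pi_pos
  simp only [partialSum_sub_eq_convolution hφ hn hM fun k hk =>
    (hψ.1 k (one_le_cast (hn.trans hk))).ne']
  rw [pnorm_ofReal]
  have h1 := (pnorm_convolution_le hφ.1.2 hφ1
    (continuous_cosPoly n M (fun k => ψ k) (β * π / 2)) (cosPoly_periodic _ _ _ _) hs).trans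
    (pnorm_cosPoly_psi_le hs hss' hψ hS hg hα hn M (β * π / 2))
  have h2 := eLpNorm_const_smul (1 / π)
    (fun x => ∫ t, φ t * cosPoly n M (fun k => ψ k) (β * π / 2) (x - t) ∂periodMeasure)
    (ENNReal.ofReal s) periodMeasure
  calc _ = ‖1 / π‖ₑ * pnorm
        (fun x => ∫ t, φ t * cosPoly n M (fun k => ψ k) (β * π / 2) (x - t) ∂periodMeasure)
        (ENNReal.ofReal s) := h2
    _ ≤ _ := by
        rw [ENNReal.ofReal_mul (by positivity), Real.enorm_of_nonneg (by positivity)]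
        gcongr

theorem conjExponent_eq (hs : 1 < s) (hss' : 1 / s + 1 / s' = 1) : Real.conjExponent s' = s := by
  have hs0 : s ≠ 0 := by linarith
  have hs' : s' ≠ 0 := by
    rintro rfl
    rw [div_zero, add_zero, div_eq_one_iff_eq hs0] at hss'
    linarith
  field_simp at hss'
  have h1 : s' - 1 ≠ 0 := by
    intro h
    have : s' = 1 := by linarith
    rw [this] at hss'
    linarith
  rw [Real.conjExponent, div_eq_iff h1]
  linarith

theorem bestOrthClass_le (hs : 1 < s) (hss' : 1 / s + 1 / s' = 1) (hψ : ψ ∈ frakM)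
    (hS : Summable fun k : ℕ => gFun ψ s' k ^ s / (k : ℝ)) (hg : gFun ψ s' ∈ frakM₀)
    (hα : s < alphaInf (gFun ψ s') 1) {n : ℕ} (hn : 1 ≤ n) :
    bestOrthClass (2 * n - 1) (LClass (fun k : ℕ => ψ k) β 1) (ENNReal.ofReal s) ≤
      ENNReal.ofReal (K₂ ψ s' * tailSum ψ s n ^ (1 / s)) := by
  have hpos := Real.pi_pos
  have hs0 : 0 < s := by linarith
  refine iSup₂_le fun f hf => ?_
  obtain ⟨hf1, φ, hφ, -, hφ1⟩ := hf
  set a := alphaInf (gFun ψ s') 1 with ha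
  have ha0 : 0 < a := by linarith
  set E : ℕ → ℝ≥0∞ := fun n => ENNReal.ofReal (1 / π * (xi s *
    ((1 + s / a) * gTail (gFun ψ s') s n) ^ (1 / s))) with hE
  have hE0 : Tendsto E atTop (𝓝 0) := by
    have h1 : Tendsto (fun n => (1 + s / a) * gTail (gFun ψ s') s n) atTop (𝓝 0) := by
      simpa using (gTail_tendsto_zero (g := gFun ψ s') (s := s)).const_mul (1 + s / a)
    have h2 := h1.rpow_const (p := 1 / s) (Or.inr (by positivity))
    rw [Real.zero_rpow (by positivity)] at h2
    have h3 := ENNReal.tendsto_ofReal ((h2.const_mul (xi s)).const_mul (1 / π))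
    rwa [mul_zero, mul_zero, ENNReal.ofReal_zero] at h3
  have hmain := pnorm_sub_partialSum_le hf1 hs hE0
    (fun n M hn hM => pnorm_partialSum_sub_le hs hss' hψ hS hg hα hφ hφ1 hn hM) hn
  have hcard : (Finset.Ioo (-n : ℤ) n).card = 2 * n - 1 := by
    rw [Int.card_Ioo]
    omega
  have hbest : bestOrth (2 * n - 1) f (ENNReal.ofReal s) ≤
      pnorm (fun x => (f x : ℂ) - partialSum (Finset.Ioo (-n : ℤ) n) f x) (ENNReal.ofReal s) :=
    iInf_le (fun γ : {γ : Finset ℤ // γ.card = 2 * n - 1} =>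
      pnorm (fun x => (f x : ℂ) - partialSum γ.1 f x) (ENNReal.ofReal s)) ⟨_, hcard⟩
  refine hbest.trans (hmain.trans (le_of_eq (congrArg ENNReal.ofReal ?_)))
  rw [K₂]
  rw [conjExponent_eq hs hss', tailSum_eq_gTail hs hss' hψ hn, ← ha,
    Real.mul_rpow (by positivity) (gTail_nonneg hg hn), show 1 + s / a = (s + a) / a by
      field_simp
      ring]
  ring

end Upper

/-! ### Monotonicity in the number of harmonics -/

theorem norm_coef_le {φ : ℝ → ℝ} (hper : Function.Periodic φ (2 * π)) (k : ℤ) :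
    ‖coef φ k‖ ≤ 1 / (2 * π) * ∫ t, ‖φ t‖ ∂periodMeasure := by
  have hpos := Real.pi_pos
  rw [coef_eq_integral hper, norm_mul]
  have h1 : ‖(1 / (2 * π) : ℂ)‖ = 1 / (2 * π) := by
    rw [show (1 / (2 * π) : ℂ) = ((1 / (2 * π) : ℝ) : ℂ) by push_cast; rfl, Complex.norm_real,
      Real.norm_of_nonneg (by positivity)]
  rw [h1]
  refine mul_le_mul_of_nonneg_left ((norm_integral_le_integral_norm _).trans (le_of_eq ?_))
    (by positivity)
  refine integral_congr_ae (Eventually.of_forall fun t => ?_)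
  simp only
  rw [norm_mul, norm_exp_I_mul_int, mul_one, Complex.norm_real]

theorem tendsto_coef {ψ : ℕ → ℝ} {β : ℝ} {f φ : ℝ → ℝ} (h : IsPsiBetaDeriv ψ β f φ)
    (hψ : ∀ k, 1 ≤ k → ψ k ≠ 0) (hlim : Tendsto ψ atTop (𝓝 0)) :
    Tendsto (fun k : ℕ => ‖coef f k‖) atTop (𝓝 0) := by
  have h1 : Tendsto (fun k => |ψ k| * (1 / (2 * π) * ∫ t, ‖φ t‖ ∂periodMeasure)) atTop (𝓝 0) := by
    simpa using hlim.abs.mul_const (1 / (2 * π) * ∫ t, ‖φ t‖ ∂periodMeasure)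
  refine squeeze_zero' (Eventually.of_forall fun _ => norm_nonneg _) ?_ h1
  filter_upwards [eventually_ge_atTop 1] with k hk
  rw [coef_eq_of_deriv h (by exact_mod_cast (by omega : k ≠ 0)) (by simpa using hψ k hk), norm_mul,
    norm_mul, Int.natAbs_natCast, Complex.norm_real, Real.norm_eq_abs, mul_assoc]
  refine mul_le_mul_of_nonneg_left ?_ (abs_nonneg _)
  rw [show ∀ z : ℝ, -(Complex.I * (z : ℂ)) = ((-z : ℝ) : ℂ) * Complex.I from fun z => by
    push_cast; ring, Complex.norm_exp_ofReal_mul_I, one_mul]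
  exact norm_coef_le h.1.1 k

/-- Enlarging the number of harmonics does not increase the error: a harmonic of arbitrarily small
amplitude can be added to any spectrum. -/
theorem bestOrth_succ_le {f : ℝ → ℝ} (hf : MemL f 1)
    (hcoef : Tendsto (fun k : ℕ => ‖coef f k‖) atTop (𝓝 0)) {s : ℝ} (hs : 1 < s) (m : ℕ) :
    bestOrth (m + 1) f (ENNReal.ofReal s) ≤ bestOrth m f (ENNReal.ofReal s) := by
  refine le_iInf fun γ => ?_
  obtain ⟨γ, hγ⟩ := γ
  simp only
  set C := periodMeasure univ ^ (ENNReal.ofReal s).toReal⁻¹ with hC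
  have hCfin : C ≠ ∞ :=
    ENNReal.rpow_ne_top_of_nonneg (inv_nonneg.2 ENNReal.toReal_nonneg) (measure_ne_top _ _)
  have hlim : Tendsto (fun k : ℕ => pnorm (fun x => (f x : ℂ) - partialSum γ f x)
      (ENNReal.ofReal s) + C * ENNReal.ofReal ‖coef f k‖) atTop
      (𝓝 (pnorm (fun x => (f x : ℂ) - partialSum γ f x) (ENNReal.ofReal s))) := by
    have h1 := ENNReal.Tendsto.const_mul (ENNReal.tendsto_ofReal hcoef) (Or.inr hCfin) (a := C)
    rw [ENNReal.ofReal_zero, mul_zero] at h1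
    simpa using h1.const_add (pnorm (fun x => (f x : ℂ) - partialSum γ f x) (ENNReal.ofReal s))
  refine ge_of_tendsto hlim ?_
  obtain ⟨B, hB⟩ := γ.exists_le
  filter_upwards [eventually_gt_atTop B.natAbs] with k hk
  have hkγ : (k : ℤ) ∉ γ := fun hmem => by
    have := hB k hmem
    omega
  have hcard : (insert (k : ℤ) γ).card = m + 1 := by rw [Finset.card_insert_of_notMem hkγ, hγ]
  have hsplit : (fun x => (f x : ℂ) - partialSum (insert (k : ℤ) γ) f x) =
      (fun x => (f x : ℂ) - partialSum γ f x) +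
        fun x : ℝ => -(coef f k * Complex.exp (Complex.I * (k : ℤ) * x)) := by
    ext x
    rw [Pi.add_apply, partialSum, Finset.sum_insert hkγ, partialSum]
    ring
  have hbest : bestOrth (m + 1) f (ENNReal.ofReal s) ≤
      pnorm (fun x => (f x : ℂ) - partialSum (insert (k : ℤ) γ) f x) (ENNReal.ofReal s) :=
    iInf_le (fun γ : {γ : Finset ℤ // γ.card = m + 1} =>
      pnorm (fun x => (f x : ℂ) - partialSum γ.1 f x) (ENNReal.ofReal s)) ⟨_, hcard⟩
  refine hbest.trans ?_
  rw [hsplit]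
  refine (eLpNorm_add_le ?_ ?_ (ENNReal.one_le_ofReal.2 hs.le)).trans (add_le_add le_rfl ?_)
  · exact (memLp_one_iff_integrable.1 hf.2).ofReal.aestronglyMeasurable.sub
      (continuous_partialSum γ f).aestronglyMeasurable
  · exact Continuous.aestronglyMeasurable (by fun_prop)
  · refine eLpNorm_le_of_ae_bound (Eventually.of_forall fun x => ?_)
    rw [norm_neg, norm_mul, norm_exp_I_mul_int, mul_one]

theorem bestOrthClass_succ_le {ψ : ℝ → ℝ} (hψ : ψ ∈ frakM) {s : ℝ} (hs : 1 < s) (β : ℝ) (m : ℕ) :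
    bestOrthClass (m + 1) (LClass (fun k : ℕ => ψ k) β 1) (ENNReal.ofReal s) ≤
      bestOrthClass m (LClass (fun k : ℕ => ψ k) β 1) (ENNReal.ofReal s) := by
  refine iSup₂_mono fun f hf => ?_
  obtain ⟨hf1, φ, hφ, -, -⟩ := hf
  exact bestOrth_succ_le hf1 (tendsto_coef hφ (fun k hk => (hψ.1 k (one_le_cast hk)).ne')
    (hψ.2.2.2.comp tendsto_natCast_atTop_atTop)) hs m

/-! ### Fejér kernels and the extremal polynomials -/

/-- The modulus squared of the Dirichlet sum is a multiple of the Fejér kernel. -/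
theorem normSq_sum_exp (N : ℕ) (x : ℝ) :
    (∑ j ∈ Finset.range N, Real.cos (j * x)) ^ 2 + (∑ j ∈ Finset.range N, Real.sin (j * x)) ^ 2 =
      N + 2 * ∑ k ∈ Finset.Ico 1 N, ((N : ℝ) - k) * Real.cos (k * x) := by
  induction N with
  | zero => simp
  | succ N ih =>
    have hcross : Real.cos (N * x) * ∑ j ∈ Finset.range N, Real.cos (j * x) +
        Real.sin (N * x) * ∑ j ∈ Finset.range N, Real.sin (j * x) =
          ∑ k ∈ Finset.Ico 1 (N + 1), Real.cos (k * x) := by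
      rw [Finset.mul_sum, Finset.mul_sum, ← Finset.sum_add_distrib, Finset.sum_Ico_eq_sum_range,
        ← Finset.sum_range_reflect]
      simp only [Nat.add_sub_cancel]
      refine Finset.sum_congr rfl fun j hj => ?_
      have hj := Finset.mem_range.1 hj
      rw [← Real.cos_sub]
      congr 1
      have : ((N - 1 - j : ℕ) : ℝ) = N - 1 - j := by
        rw [Nat.sub_sub, Nat.cast_sub (by omega)]
        push_cast
        ring
      push_cast
      rw [this]
      ring
    have hsum : ∑ k ∈ Finset.Ico 1 (N + 1), (((N + 1 : ℕ) : ℝ) - k) * Real.cos (k * x) =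
        ∑ k ∈ Finset.Ico 1 N, ((N : ℝ) - k) * Real.cos (k * x) +
          ∑ k ∈ Finset.Ico 1 (N + 1), Real.cos (k * x) := by
      rcases Nat.eq_zero_or_pos N with rfl | hN
      · simp
      · have h1 : ∑ k ∈ Finset.Ico 1 N, ((N : ℝ) - k) * Real.cos (k * x) =
            ∑ k ∈ Finset.Ico 1 (N + 1), ((N : ℝ) - k) * Real.cos (k * x) := by
          rw [Finset.sum_Ico_succ_top hN, sub_self, zero_mul, add_zero]
        rw [h1, ← Finset.sum_add_distrib]
        refine Finset.sum_congr rfl fun k _ => ?_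
        push_cast
        ring
    rw [Finset.sum_range_succ, Finset.sum_range_succ, hsum]
    push_cast
    linear_combination ih + 2 * hcross + Real.sin_sq_add_cos_sq (N * x)

theorem coef_cosPoly {n : ℕ} (hn : 1 ≤ n) (M : ℕ) (c : ℕ → ℝ) (θ : ℝ) (k : ℤ) :
    coef (cosPoly n M c θ) k = if k.natAbs ∈ Finset.Ico n M then
      (c k.natAbs : ℂ) / 2 * Complex.exp (-(Complex.I * ((θ * (k.sign : ℝ) : ℝ) : ℂ))) else 0 := by
  have hπ : (π : ℂ) ≠ 0 := by exact_mod_cast Real.pi_ne_zero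
  have h1 : ∀ t : ℝ, (cosPoly n M c θ t : ℂ) * Complex.exp (Complex.I * (-k : ℤ) * t) =
      ∑ j ∈ Finset.Ico n M, ((c j : ℂ) / 2 * Complex.exp (-(Complex.I * θ)) *
        Complex.exp (Complex.I * (j - k : ℤ) * t) +
        (c j : ℂ) / 2 * Complex.exp (Complex.I * θ) *
          Complex.exp (Complex.I * (-j - k : ℤ) * t)) := by
    intro t
    rw [cosPoly, Complex.ofReal_sum, Finset.sum_mul]
    refine Finset.sum_congr rfl fun j _ => ?_
    have e0 := Complex.two_cos (((j * t - θ : ℝ) : ℂ))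
    rw [← Complex.ofReal_cos] at e0
    have e1 : Complex.exp (-(Complex.I * θ)) * Complex.exp (Complex.I * (j - k : ℤ) * t) =
        Complex.exp (((j * t - θ : ℝ) : ℂ) * Complex.I) *
          Complex.exp (Complex.I * (-k : ℤ) * t) := by
      rw [← Complex.exp_add, ← Complex.exp_add]
      congr 1
      push_cast
      ring
    have e2 : Complex.exp (Complex.I * θ) * Complex.exp (Complex.I * (-j - k : ℤ) * t) =
        Complex.exp (-((j * t - θ : ℝ) : ℂ) * Complex.I) *
          Complex.exp (Complex.I * (-k : ℤ) * t) := by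
      rw [← Complex.exp_add, ← Complex.exp_add]
      congr 1
      push_cast
      ring
    rw [Complex.ofReal_mul]
    linear_combination (c j : ℂ) / 2 * Complex.exp (Complex.I * (-k : ℤ) * t) * e0 -
      (c j : ℂ) / 2 * e1 - (c j : ℂ) / 2 * e2
  rw [coef_eq_integral (cosPoly_periodic n M c θ)]
  simp only [h1]
  rw [integral_finsetSum _ fun j _ => integrable_periodMeasure_of_continuous (by fun_prop)]
  have h2 : ∀ j ∈ Finset.Ico n M, ∫ t, ((c j : ℂ) / 2 * Complex.exp (-(Complex.I * θ)) *
        Complex.exp (Complex.I * (j - k : ℤ) * t) +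
        (c j : ℂ) / 2 * Complex.exp (Complex.I * θ) *
          Complex.exp (Complex.I * (-j - k : ℤ) * t)) ∂periodMeasure =
      if j = k.natAbs then
        2 * π * ((c j : ℂ) / 2 * Complex.exp (-(Complex.I * ((θ * (k.sign : ℝ) : ℝ) : ℂ))))
      else 0 := by
    intro j hj
    have hj1 : 1 ≤ j := hn.trans (Finset.mem_Ico.1 hj).1
    rw [integral_add (integrable_periodMeasure_of_continuous (by fun_prop))
      (integrable_periodMeasure_of_continuous (by fun_prop)), integral_const_mul,
      integral_const_mul, integral_exp_periodMeasure, integral_exp_periodMeasure]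
    split_ifs with h3 h4 h5 h5 h5 h5 h5
    all_goals first | omega | skip
    · rw [Int.sign_eq_one_of_pos (by omega)]
      push_cast
      simp only [mul_one, mul_zero, add_zero]
      ring
    · rw [Int.sign_eq_neg_one_of_neg (by omega)]
      push_cast
      simp only [mul_zero, zero_add, mul_neg, mul_one, neg_neg]
      ring
    · simp
  rw [Finset.sum_congr rfl h2, Finset.sum_ite_eq']
  split_ifs
  · field_simp
  · simp

/-- The Fejér means of `δ₀ - 1 / (2π)`, halved: `φ_N = (F_N - 1) / (4π)`, where
`F_N(x) = 1 + 2 ∑_{k < N} (1 - k / N) cos (k x)` is the Fejér kernel. The factor `1 / 2` makes the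
`L₁` norm at most one although `φ_N` has mean value zero. -/
noncomputable def fejerDelta (N : ℕ) : ℝ → ℝ :=
  cosPoly 1 N (fun k => (1 - (k : ℝ) / N) / (2 * π)) 0

theorem neg_le_fejerDelta {N : ℕ} (hN : 1 ≤ N) (x : ℝ) : -(1 / (4 * π)) ≤ fejerDelta N x := by
  have hpos := Real.pi_pos
  have hN0 : (0 : ℝ) < N := by linarith [one_le_cast hN]
  have h := normSq_sum_exp N x
  have h1 : fejerDelta N x =
      1 / (4 * π * N) * (2 * ∑ k ∈ Finset.Ico 1 N, ((N : ℝ) - k) * Real.cos (k * x)) := by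
    rw [fejerDelta, cosPoly, ← mul_assoc, Finset.mul_sum]
    refine Finset.sum_congr rfl fun k _ => ?_
    rw [sub_zero]
    field_simp
    ring
  have h2 : -(N : ℝ) ≤ 2 * ∑ k ∈ Finset.Ico 1 N, ((N : ℝ) - k) * Real.cos (k * x) := by
    nlinarith [sq_nonneg (∑ j ∈ Finset.range N, Real.cos (j * x)),
      sq_nonneg (∑ j ∈ Finset.range N, Real.sin (j * x))]
  rw [h1]
  calc -(1 / (4 * π)) = 1 / (4 * π * N) * -(N : ℝ) := by field_simp
    _ ≤ _ := by gcongr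

theorem integral_cosPoly {n : ℕ} (hn : 1 ≤ n) (M : ℕ) (c : ℕ → ℝ) (θ : ℝ) :
    ∫ x, cosPoly n M c θ x ∂periodMeasure = 0 := by
  have h1 := integral_exp_mul_eq_coef (cosPoly_periodic n M c θ) 0
  rw [coef_cosPoly hn, if_neg (by simp; omega), mul_zero] at h1
  simp only [Int.cast_zero, mul_zero, zero_mul, Complex.exp_zero, one_mul] at h1
  rw [integral_complex_ofReal] at h1
  exact_mod_cast h1

theorem pnorm_fejerDelta_le {N : ℕ} (hN : 1 ≤ N) : pnorm (fejerDelta N) 1 ≤ 1 := by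
  have hpos := Real.pi_pos
  have hcont : Continuous (fejerDelta N) := continuous_cosPoly _ _ _ _
  have hle : ∀ x, |fejerDelta N x| ≤ fejerDelta N x + 1 / (2 * π) := by
    intro x
    have h := neg_le_fejerDelta hN x
    have h2 : 1 / (2 * π) = 2 * (1 / (4 * π)) := by
      field_simp
      norm_num
    have h3 : 0 < 1 / (4 * π) := by positivity
    rw [abs_le]
    constructor <;> linarith
  have hint : Integrable (fun x => fejerDelta N x + 1 / (2 * π)) periodMeasure :=
    integrable_periodMeasure_of_continuous (hcont.add continuous_const)
  have hvol : periodMeasure.real univ = 2 * π := by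
    rw [Measure.real, periodMeasure, Measure.restrict_apply_univ, Real.volume_Ico, sub_zero,
      ENNReal.toReal_ofReal (by positivity)]
  rw [pnorm, eLpNorm_one_eq_lintegral_enorm]
  calc ∫⁻ x, ‖fejerDelta N x‖ₑ ∂periodMeasure
      ≤ ∫⁻ x, ENNReal.ofReal (fejerDelta N x + 1 / (2 * π)) ∂periodMeasure := by
        refine lintegral_mono fun x => ?_
        rw [← ofReal_norm]
        exact ENNReal.ofReal_le_ofReal (hle x)
    _ = ENNReal.ofReal (∫ x, (fejerDelta N x + 1 / (2 * π)) ∂periodMeasure) :=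
        (ofReal_integral_eq_lintegral_ofReal hint
          (Eventually.of_forall fun x => (abs_nonneg _).trans (hle x))).symm
    _ = 1 := by
        rw [integral_add (integrable_periodMeasure_of_continuous hcont) (integrable_const _),
          integral_const, hvol, fejerDelta, integral_cosPoly le_rfl, smul_eq_mul, zero_add,
          mul_one_div_cancel (by positivity), ENNReal.ofReal_one]

/-- The function whose `(ψ, β)`-derivative is `fejerDelta N`. -/
noncomputable def extremalPoly (ψ : ℝ → ℝ) (β : ℝ) (N : ℕ) : ℝ → ℝ :=
  cosPoly 1 N (fun k => ψ k * ((1 - (k : ℝ) / N) / (2 * π))) (β * π / 2)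

theorem memL_cosPoly (n M : ℕ) (c : ℕ → ℝ) (θ : ℝ) (p : ℝ≥0∞) : MemL (cosPoly n M c θ) p :=
  ⟨cosPoly_periodic n M c θ, memLp_of_continuous (continuous_cosPoly n M c θ) p⟩

theorem extremalPoly_mem_LClass {ψ : ℝ → ℝ} (hψ : ψ ∈ frakM) (β : ℝ) {N : ℕ} (hN : 1 ≤ N) :
    extremalPoly ψ β N ∈ LClass (fun k : ℕ => ψ k) β 1 := by
  refine ⟨memL_cosPoly _ _ _ _ _, fejerDelta N, ⟨memL_cosPoly _ _ _ _ _, ?_, fun k hk => ?_⟩,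
    memL_cosPoly _ _ _ _ _, pnorm_fejerDelta_le hN⟩
  · rw [fejerDelta, coef_cosPoly le_rfl, if_neg (by simp)]
  · rw [fejerDelta, extremalPoly, coef_cosPoly le_rfl, coef_cosPoly le_rfl]
    split_ifs
    · have hψk : (ψ k.natAbs : ℂ) ≠ 0 := by
        exact_mod_cast (hψ.1 _ (one_le_cast (by omega))).ne'
      rw [Complex.exp_neg (Complex.I * ((β * π / 2 * (k.sign : ℝ) : ℝ) : ℂ))]
      have hexp := Complex.exp_ne_zero (Complex.I * ((β * π / 2 * (k.sign : ℝ) : ℝ) : ℂ))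
      generalize Complex.exp (Complex.I * ((β * π / 2 * (k.sign : ℝ) : ℝ) : ℂ)) = e at hexp ⊢
      simp only [zero_mul, Complex.ofReal_zero, mul_zero, neg_zero, Complex.exp_zero]
      push_cast
      field_simp
    · simp

/-! ### The lower bound -/

theorem sum_Ioo_natAbs (F : ℕ → ℝ) {N : ℕ} (hN : 1 ≤ N) :
    ∑ k ∈ Finset.Ioo (-N : ℤ) N, F k.natAbs = F 0 + 2 * ∑ k ∈ Finset.Ico 1 N, F k := by
  induction N, hN using Nat.le_induction with
  | base =>
    have : Finset.Ioo (-(1 : ℕ) : ℤ) (1 : ℕ) = {0} := by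
      ext k
      simp only [Finset.mem_Ioo, Finset.mem_singleton]
      omega
    rw [this]
    simp
  | succ N hN ih =>
    have hset : Finset.Ioo (-(N + 1 : ℕ) : ℤ) (N + 1 : ℕ) =
        insert (N : ℤ) (insert (-N : ℤ) (Finset.Ioo (-N : ℤ) N)) := by
      ext k
      simp only [Finset.mem_insert, Finset.mem_Ioo]
      omega
    rw [Finset.sum_Ico_succ_top hN, hset, Finset.sum_insert, Finset.sum_insert, ih]
    · simp only [Int.natAbs_neg, Int.natAbs_natCast]
      ring
    · simp
    · simp only [Finset.mem_insert, Finset.mem_Ioo]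
      omega

/-- Among all spectra of `2n` harmonics, the one carrying the largest part of a weight `w(|k|)` that
vanishes for `|k| < n` and decreases afterwards is `n ≤ |k| < 2n`. The excess of `w` over the
threshold `w(2n)` is supported there. -/
theorem sum_natAbs_le {w : ℕ → ℝ} {n : ℕ} (hn : 1 ≤ n) (hw0 : ∀ k, 0 ≤ w k)
    (hlow : ∀ k, k < n → w k = 0) (hw : AntitoneOn w (Ici n)) {γ : Finset ℤ}
    (hγ : γ.card = 2 * n) :
    ∑ k ∈ γ, w k.natAbs ≤ 2 * ∑ k ∈ Finset.Ico n (2 * n), w k := by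
  set τ := w (2 * n) with hτ
  set F : ℕ → ℝ := fun k => max (w k - τ) 0 with hF
  have hF0 : ∀ k, 0 ≤ F k := fun k => le_max_right _ _
  have hFlow : ∀ k, k < n → F k = 0 := fun k hk => by
    simp only [hF, hlow k hk]
    exact max_eq_right (by linarith [hw0 (2 * n)])
  have hFhigh : ∀ k, 2 * n ≤ k → F k = 0 := fun k hk => by
    simp only [hF]
    refine max_eq_right ?_
    have : w k ≤ w (2 * n) := hw (mem_Ici.2 (by omega)) (mem_Ici.2 (by omega)) hk
    linarith
  have hFmid : ∀ k ∈ Finset.Ico n (2 * n), F k = w k - τ := fun k hk => by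
    obtain ⟨h1, h2⟩ := Finset.mem_Ico.1 hk
    simp only [hF]
    refine max_eq_left ?_
    have : w (2 * n) ≤ w k := hw h1 (mem_Ici.2 (by omega)) h2.le
    linarith
  have h1 : ∑ k ∈ γ, w k.natAbs ≤ ∑ k ∈ γ, (F k.natAbs + τ) :=
    Finset.sum_le_sum fun k _ => by linarith [le_max_left (w k.natAbs - τ) 0]
  have h2 : ∑ k ∈ γ, F k.natAbs ≤ ∑ k ∈ Finset.Ioo (-(2 * n : ℕ) : ℤ) (2 * n : ℕ), F k.natAbs := by
    rw [← Finset.sum_filter_of_ne (p := fun k => k ∈ Finset.Ioo (-(2 * n : ℕ) : ℤ) (2 * n : ℕ))]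
    · refine Finset.sum_le_sum_of_subset_of_nonneg (fun k hk => (Finset.mem_filter.1 hk).2)
        fun k _ _ => hF0 _
    · intro k _ hne
      by_contra hk
      refine hne (hFhigh _ ?_)
      rw [Finset.mem_Ioo] at hk
      omega
  have h3 : ∑ k ∈ Finset.Ico 1 (2 * n), F k = ∑ k ∈ Finset.Ico n (2 * n), w k - n * τ := by
    rw [← Finset.sum_Ico_consecutive F hn (by omega), Finset.sum_eq_zero fun k hk =>
      hFlow k (Finset.mem_Ico.1 hk).2, zero_add, Finset.sum_congr rfl hFmid,
      Finset.sum_sub_distrib, Finset.sum_const, Nat.card_Ico, nsmul_eq_mul,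
      show 2 * n - n = n by omega]
  rw [sum_Ioo_natAbs F (by omega), hFlow 0 (by omega), h3] at h2
  rw [Finset.sum_add_distrib, Finset.sum_const, hγ, nsmul_eq_mul] at h1
  push_cast at h1
  linarith

/-- Hölder's inequality over a period. -/
theorem norm_integral_mul_le {u : ℝ → ℂ} (hu : AEStronglyMeasurable u periodMeasure) {h : ℝ → ℝ}
    (hh : Continuous h) {s s' : ℝ} (hpq : s.HolderConjugate s') :
    ‖∫ x, u x * (h x : ℂ) ∂periodMeasure‖ₑ ≤
      pnorm u (ENNReal.ofReal s) * pnorm h (ENNReal.ofReal s') := by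
  have h0 : ENNReal.ofReal s ≠ 0 := by simpa using hpq.pos
  have h0' : ENNReal.ofReal s' ≠ 0 := by simpa using hpq.symm.pos
  rw [pnorm, pnorm, eLpNorm_eq_lintegral_rpow_enorm_toReal h0 ENNReal.ofReal_ne_top,
    eLpNorm_eq_lintegral_rpow_enorm_toReal h0' ENNReal.ofReal_ne_top,
    ENNReal.toReal_ofReal hpq.nonneg, ENNReal.toReal_ofReal hpq.symm.nonneg]
  refine (enorm_integral_le_lintegral_enorm _).trans (le_trans (le_of_eq ?_)
    (ENNReal.lintegral_mul_le_Lp_mul_Lq periodMeasure hpq hu.enorm hh.measurable.enorm.aemeasurable))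
  refine lintegral_congr fun x => ?_
  rw [enorm_mul, Pi.mul_apply]
  congr 1
  rw [← ofReal_norm, Complex.norm_real, ofReal_norm]

/-- Integrating a partial sum of a cosine polynomial against another cosine polynomial with the same
phase: the phases cancel. -/
theorem integral_partialSum_cosPoly {n : ℕ} (hn : 1 ≤ n) {M N : ℕ} (hMN : M ≤ N) (c b : ℕ → ℝ)
    (θ : ℝ) (γ : Finset ℤ) :
    ∫ x, partialSum γ (cosPoly 1 N c θ) x * (cosPoly n M b θ x : ℂ) ∂periodMeasure =
      ((π / 2 * ∑ k ∈ γ, if k.natAbs ∈ Finset.Ico n M then c k.natAbs * b k.natAbs else 0 : ℝ) :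
        ℂ) := by
  have hcont := continuous_cosPoly n M b θ
  simp only [partialSum, Finset.sum_mul, mul_assoc]
  rw [integral_finsetSum _ fun j _ => integrable_periodMeasure_of_continuous (by fun_prop),
    Finset.mul_sum, Complex.ofReal_sum]
  refine Finset.sum_congr rfl fun k _ => ?_
  simp only [← mul_assoc Complex.I]
  rw [integral_const_mul, integral_exp_mul_eq_coef (cosPoly_periodic n M b θ), coef_cosPoly hn,
    coef_cosPoly le_rfl, Int.natAbs_neg]
  by_cases h1 : k.natAbs ∈ Finset.Ico n M
  · have h2 : k.natAbs ∈ Finset.Ico 1 N := by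
      rw [Finset.mem_Ico] at h1 ⊢
      omega
    rw [if_pos h1, if_pos h1, if_pos h2]
    have h3 : Complex.exp (-(Complex.I * ((θ * (k.sign : ℝ) : ℝ) : ℂ))) *
        Complex.exp (-(Complex.I * ((θ * ((-k).sign : ℝ) : ℝ) : ℂ))) = 1 := by
      rw [← Complex.exp_add, Int.sign_neg]
      push_cast
      rw [show -(Complex.I * (θ * k.sign)) + -(Complex.I * (θ * -(k.sign : ℂ))) = 0 by ring,
        Complex.exp_zero]
    push_cast at h3 ⊢
    linear_combination (π : ℂ) / 2 * c k.natAbs * b k.natAbs * h3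
  · rw [if_neg h1, if_neg h1]
    simp

theorem cosPoly_eq_partialSum {N : ℕ} (hN : 1 ≤ N) (c : ℕ → ℝ) (θ x : ℝ) :
    (cosPoly 1 N c θ x : ℂ) = partialSum (Finset.Ioo (-N : ℤ) N) (cosPoly 1 N c θ) x := by
  have h1 := partialSum_Ioo_sub le_rfl hN (cosPoly 1 N c θ) x
  have h0 : partialSum (Finset.Ioo (-(1 : ℕ) : ℤ) (1 : ℕ)) (cosPoly 1 N c θ) x = 0 := by
    refine Finset.sum_eq_zero fun k hk => ?_
    rw [coef_cosPoly le_rfl, if_neg, zero_mul]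
    rw [Finset.mem_Ioo] at hk
    rw [Finset.mem_Ico]
    omega
  rw [h0, sub_zero] at h1
  rw [h1, cosPoly, Complex.ofReal_sum]
  refine Finset.sum_congr rfl fun k hk => ?_
  have hk1 : 1 ≤ k := (Finset.mem_Ico.1 hk).1
  rw [coef_cosPoly le_rfl, coef_cosPoly le_rfl, Int.natAbs_neg, Int.natAbs_natCast, if_pos hk,
    if_pos hk, Int.sign_neg, Int.sign_eq_one_of_pos (by omega)]
  have e0 := Complex.two_cos (((k * x - θ : ℝ) : ℂ))
  rw [← Complex.ofReal_cos] at e0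
  have e1 : Complex.exp (-(Complex.I * ((θ * ((1 : ℤ) : ℝ) : ℝ) : ℂ))) *
      Complex.exp (Complex.I * (k : ℤ) * x) =
        Complex.exp (((k * x - θ : ℝ) : ℂ) * Complex.I) := by
    rw [← Complex.exp_add]
    congr 1
    push_cast
    ring
  have e2 : Complex.exp (-(Complex.I * ((θ * ((-1 : ℤ) : ℝ) : ℝ) : ℂ))) *
      Complex.exp (Complex.I * (-k : ℤ) * x) =
        Complex.exp (-((k * x - θ : ℝ) : ℂ) * Complex.I) := by
    rw [← Complex.exp_add]
    congr 1
    push_cast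
    ring
  rw [Complex.ofReal_mul]
  linear_combination (c k : ℂ) / 2 * e0 - (c k : ℂ) / 2 * e1 - (c k : ℂ) / 2 * e2

section Lower

variable {ψ : ℝ → ℝ} {s s' : ℝ}

/-- Pairing the error of an arbitrary approximation of `extremalPoly` by `2n` of its harmonics with
the test polynomial leaves at least the part of the tail beyond `2n`. -/
theorem le_pairing (hs : 1 < s) (hss' : 1 / s + 1 / s' = 1) (hg : gFun ψ s' ∈ frakM₀)
    (β : ℝ) {n M N : ℕ} (hn : 1 ≤ n) (hM : 2 * n ≤ M) (hMN : M ≤ N) {γ : Finset ℤ}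
    (hγ : γ.card = 2 * n) :
    ENNReal.ofReal (1 / 2 * ((1 - (M : ℝ) / N) *
        ∑ k ∈ Finset.Ico (2 * n) M, gFun ψ s' k ^ s / (k : ℝ))) ≤
      ‖∫ x, ((extremalPoly ψ β N x : ℂ) - partialSum γ (extremalPoly ψ β N) x) *
        (cosPoly n M (testCoef (gFun ψ s') s) (β * π / 2) x : ℂ) ∂periodMeasure‖ₑ := by
  have hpos := Real.pi_pos
  have hN1 : 1 ≤ N := by omega
  have hN0 : (0 : ℝ) < N := by linarith [one_le_cast hN1]
  set g := gFun ψ s' with hgdef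
  set c : ℕ → ℝ := fun k => ψ k * ((1 - (k : ℝ) / N) / (2 * π)) with hc
  set t : ℕ → ℝ := fun k => g k ^ s / (k : ℝ) with ht
  set w : ℕ → ℝ := fun k => if k ∈ Finset.Ico n M then (1 - (k : ℝ) / N) * t k else 0 with hw
  have ht0 : ∀ k, 1 ≤ k → 0 ≤ t k := fun k hk => gTerm_nonneg hg hk
  have hlam : ∀ k, k ≤ M → 0 ≤ 1 - (k : ℝ) / N := fun k hk => by
    rw [sub_nonneg, div_le_one hN0]
    exact Nat.cast_le.2 (hk.trans hMN)
  have hw0 : ∀ k, 0 ≤ w k := fun k => by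
    simp only [hw]
    split_ifs with h
    · rw [Finset.mem_Ico] at h
      exact mul_nonneg (hlam k h.2.le) (ht0 k (hn.trans h.1))
    · exact le_rfl
  have hlow : ∀ k, k < n → w k = 0 := fun k hk => by
    simp only [hw]
    rw [if_neg]
    rw [Finset.mem_Ico]
    omega
  have hanti : AntitoneOn w (Ici n) := by
    intro i hi j hj hij
    by_cases hjM : j ∈ Finset.Ico n M
    · have hjM' := Finset.mem_Ico.1 hjM
      have hiM : i ∈ Finset.Ico n M := Finset.mem_Ico.2 ⟨hi, by omega⟩
      simp only [hw, if_pos hjM, if_pos hiM]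
      have hi1 := one_le_cast (hn.trans hi)
      have hj1 := one_le_cast (hn.trans hj)
      have hij' : (i : ℝ) ≤ j := Nat.cast_le.2 hij
      have h1 : g j ≤ g i := antitoneOn_of_mem_frakM hg.1 hi1 hj1 hij'
      have h2 : 0 ≤ g j := (hg.1.1 j hj1).le
      have h3 : 0 ≤ g i := h2.trans h1
      have h4 : t j ≤ t i := by
        simp only [ht]
        gcongr
      have h5 : 1 - (j : ℝ) / N ≤ 1 - (i : ℝ) / N := by gcongr
      exact mul_le_mul h5 h4 (ht0 j (hn.trans hj)) (hlam i (by omega))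
    · simp only [hw, if_neg hjM]
      exact hw0 i
  have hcb : ∀ k : ℕ, (if k ∈ Finset.Ico n M then c k * testCoef g s k else 0) =
      1 / (2 * π) * w k := by
    intro k
    simp only [hw]
    split_ifs with h
    · rw [Finset.mem_Ico] at h
      have := psi_mul_testCoef hss' hg (hn.trans h.1)
      rw [← hgdef] at this
      simp only [hc, ht]
      rw [← this]
      field_simp
    · simp
  have hint : ∀ γ : Finset ℤ, ∫ x, partialSum γ (extremalPoly ψ β N) x *
      (cosPoly n M (testCoef g s) (β * π / 2) x : ℂ) ∂periodMeasure =
        ((1 / 4 * ∑ k ∈ γ, w k.natAbs : ℝ) : ℂ) := by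
    intro γ
    rw [extremalPoly, integral_partialSum_cosPoly hn hMN]
    congr 1
    rw [Finset.mul_sum, Finset.mul_sum]
    refine Finset.sum_congr rfl fun k _ => ?_
    rw [hcb k.natAbs]
    field_simp
    ring
  have hcont := continuous_cosPoly n M (testCoef g s) (β * π / 2)
  have hval : ∫ x, ((extremalPoly ψ β N x : ℂ) - partialSum γ (extremalPoly ψ β N) x) *
      (cosPoly n M (testCoef g s) (β * π / 2) x : ℂ) ∂periodMeasure =
        ((1 / 4 * (∑ k ∈ Finset.Ioo (-N : ℤ) N, w k.natAbs - ∑ k ∈ γ, w k.natAbs) : ℝ) : ℂ) := by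
    have hps : ∀ x, (extremalPoly ψ β N x : ℂ) =
        partialSum (Finset.Ioo (-N : ℤ) N) (extremalPoly ψ β N) x := fun x =>
      cosPoly_eq_partialSum hN1 _ _ x
    have h1 := hint (Finset.Ioo (-N : ℤ) N)
    have hi : ∀ γ : Finset ℤ, Integrable (fun x => partialSum γ (extremalPoly ψ β N) x *
        (cosPoly n M (testCoef g s) (β * π / 2) x : ℂ)) periodMeasure := fun γ =>
      integrable_periodMeasure_of_continuous
        ((continuous_partialSum γ _).mul (Complex.continuous_ofReal.comp hcont))
    calc _ = ∫ x, (partialSum (Finset.Ioo (-N : ℤ) N) (extremalPoly ψ β N) x *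
            (cosPoly n M (testCoef g s) (β * π / 2) x : ℂ) -
          partialSum γ (extremalPoly ψ β N) x *
            (cosPoly n M (testCoef g s) (β * π / 2) x : ℂ)) ∂periodMeasure := by
          refine integral_congr_ae (Eventually.of_forall fun x => ?_)
          simp only
          rw [hps x, sub_mul]
      _ = _ := by
          rw [integral_sub (hi _) (hi _), h1, hint γ]
          push_cast
          ring
  have hsplit : ∑ k ∈ Finset.Ico 1 N, w k =
      ∑ k ∈ Finset.Ico n (2 * n), w k + ∑ k ∈ Finset.Ico (2 * n) N, w k := by
    rw [Finset.sum_Ico_consecutive w (by omega) (by omega),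
      ← Finset.sum_Ico_consecutive w hn (by omega : n ≤ N),
      Finset.sum_eq_zero fun k hk => hlow k (Finset.mem_Ico.1 hk).2, zero_add]
  have htail : (1 - (M : ℝ) / N) * ∑ k ∈ Finset.Ico (2 * n) M, t k ≤
      ∑ k ∈ Finset.Ico (2 * n) N, w k := by
    calc _ = ∑ k ∈ Finset.Ico (2 * n) M, (1 - (M : ℝ) / N) * t k := Finset.mul_sum _ _ _
      _ ≤ ∑ k ∈ Finset.Ico (2 * n) M, w k := by
          refine Finset.sum_le_sum fun k hk => ?_
          obtain ⟨h1, h2⟩ := Finset.mem_Ico.1 hk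
          simp only [hw, if_pos (Finset.mem_Ico.2 ⟨by omega, h2⟩ : k ∈ Finset.Ico n M)]
          have h3 : (k : ℝ) ≤ M := Nat.cast_le.2 h2.le
          have := ht0 k (by omega)
          gcongr
      _ ≤ _ := Finset.sum_le_sum_of_subset_of_nonneg (Finset.Ico_subset_Ico le_rfl hMN)
          fun k _ _ => hw0 k
  have hall := sum_Ioo_natAbs w hN1
  rw [hlow 0 (by omega), zero_add, hsplit] at hall
  have hrear := sum_natAbs_le hn hw0 hlow hanti hγ
  rw [hval, ← ofReal_norm, Complex.norm_real]
  refine ENNReal.ofReal_le_ofReal (le_trans ?_ (le_abs_self _))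
  linarith

theorem le_bestOrthClass (hs : 1 < s) (hs' : 1 < s') (hss' : 1 / s + 1 / s' = 1) (hψ : ψ ∈ frakM)
    (hS : Summable fun k : ℕ => gFun ψ s' k ^ s / (k : ℝ)) (hg : gFun ψ s' ∈ frakM₀)
    (hα : s < alphaInf (gFun ψ s') 1) (β : ℝ) {n : ℕ} (hn : 1 ≤ n) :
    ENNReal.ofReal (1 / 2 * gTail (gFun ψ s') s (2 * n) /
        (xi s' * ((1 + s / alphaInf (gFun ψ s') 1) * gTail (gFun ψ s') s n) ^ (1 / s'))) ≤
      bestOrthClass (2 * n) (LClass (fun k : ℕ => ψ k) β 1) (ENNReal.ofReal s) := by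
  have hs0 : 0 < s := by linarith
  have hs'0 : 0 < s' := by linarith
  have hpq : s.HolderConjugate s' := by
    rw [Real.holderConjugate_iff]
    exact ⟨hs, by simpa [one_div] using hss'⟩
  have ha0 : 0 < alphaInf (gFun ψ s') 1 := by linarith
  have hT : 0 < gTail (gFun ψ s') s n := by
    have h1 := rpow_le_mul_gTail hg hs hα hS hn
    have h2 : 0 < gFun ψ s' n ^ s := Real.rpow_pos_of_pos (hg.1.1 n (one_le_cast hn)) s
    exact (mul_pos_iff_of_pos_left (by positivity)).1 (h2.trans_le h1)
  set H := xi s' * ((1 + s / alphaInf (gFun ψ s') 1) * gTail (gFun ψ s') s n) ^ (1 / s') with hH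
  have hH0 : 0 < H := mul_pos (xi_pos hs') (Real.rpow_pos_of_pos (by positivity) _)
  have hfin : ∀ M N : ℕ, 2 * n ≤ M → M ≤ N →
      ENNReal.ofReal (1 / 2 * ((1 - (M : ℝ) / N) *
        ∑ k ∈ Finset.Ico (2 * n) M, gFun ψ s' k ^ s / (k : ℝ)) / H) ≤
      bestOrthClass (2 * n) (LClass (fun k : ℕ => ψ k) β 1) (ENNReal.ofReal s) := by
    intro M N hM hMN
    refine le_trans ?_ (le_iSup₂ (f := fun f (_ : f ∈ LClass (fun k : ℕ => ψ k) β 1) =>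
      bestOrth (2 * n) f (ENNReal.ofReal s)) (extremalPoly ψ β N)
      (extremalPoly_mem_LClass hψ β (by omega)))
    refine le_iInf fun γ => ?_
    have h1 := le_pairing hs hss' hg β hn hM hMN γ.2
    have hmeas : AEStronglyMeasurable (fun x => (extremalPoly ψ β N x : ℂ) -
        partialSum γ.1 (extremalPoly ψ β N) x) periodMeasure :=
      ((Complex.continuous_ofReal.comp (continuous_cosPoly _ _ _ _)).sub
        (continuous_partialSum γ.1 _)).aestronglyMeasurable
    have h2 := h1.trans ((norm_integral_mul_le hmeas (continuous_cosPoly n M _ _) hpq).trans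
      (mul_le_mul_right (pnorm_cosPoly_testCoef_le hs hs' hss' hS hg hα hn M (β * π / 2)) _))
    rw [ENNReal.ofReal_div_of_pos hH0]
    exact ENNReal.div_le_of_le_mul h2
  have hlimN : ∀ M : ℕ, 2 * n ≤ M →
      ENNReal.ofReal (1 / 2 * (∑ k ∈ Finset.Ico (2 * n) M, gFun ψ s' k ^ s / (k : ℝ)) / H) ≤
      bestOrthClass (2 * n) (LClass (fun k : ℕ => ψ k) β 1) (ENNReal.ofReal s) := by
    intro M hM
    have h1 : Tendsto (fun N : ℕ => (M : ℝ) / N) atTop (𝓝 0) :=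
      tendsto_const_div_atTop_nhds_zero_nat _
    have h2 := ENNReal.tendsto_ofReal ((((h1.const_sub 1).mul_const
      (∑ k ∈ Finset.Ico (2 * n) M, gFun ψ s' k ^ s / (k : ℝ))).const_mul (1 / 2)).div_const H)
    rw [sub_zero, one_mul] at h2
    refine le_of_tendsto h2 ?_
    filter_upwards [eventually_ge_atTop M] with N hN using hfin M N hM hN
  have h3 := ENNReal.tendsto_ofReal (((tendsto_sum_Ico_gTail hS (2 * n)).const_mul
    (1 / 2)).div_const H)
  refine le_of_tendsto h3 ?_
  filter_upwards [eventually_ge_atTop (2 * n)] with M hM using hlimN M hM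

end Lower

/-- The lower estimate in terms of `T (2n)` implies the one with the constant `K₁`; there is room
between `4 / 9` and `1 / 2`. -/
theorem K₁_mul_le {ψ : ℝ → ℝ} {s s' : ℝ} (hs : 1 < s) (hs' : 1 < s') (hss' : 1 / s + 1 / s' = 1)
    (hS : Summable fun k : ℕ => gFun ψ s' k ^ s / (k : ℝ)) (hg : gFun ψ s' ∈ frakM₀)
    (hα : s < alphaInf (gFun ψ s') 1) {n : ℕ} (hn : 1 ≤ n) :
    4 / 3 * K₁ ψ s' * gTail (gFun ψ s') s n ^ (1 / s) ≤
      1 / 2 * gTail (gFun ψ s') s (2 * n) /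
        (xi s' * ((1 + s / alphaInf (gFun ψ s') 1) * gTail (gFun ψ s') s n) ^ (1 / s')) := by
  have hs0 : 0 < s := by linarith
  have h1 := one_sub_mul_gTail_le hg hs hα hS hn
  have hT0 : 0 ≤ gTail (gFun ψ s') s n := gTail_nonneg hg hn
  rw [K₁, conjExponent_eq hs hss']
  set a := alphaInf (gFun ψ s') 1
  set T := gTail (gFun ψ s') s n
  set T' := gTail (gFun ψ s') s (2 * n)
  have ha0 : 0 < a := by linarith
  have hx := xi_pos hs'
  have hq : 0 ≤ 1 - s / a := by
    rw [sub_nonneg]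
    exact (div_le_one ha0).2 hα.le
  rcases hT0.eq_or_lt with hT | hT
  · rw [← hT, Real.zero_rpow (by positivity), mul_zero, mul_zero, Real.zero_rpow (by positivity)]
    simp
  have hpow : T ^ (1 / s) * T ^ (1 / s') = T := by
    rw [← Real.rpow_add hT, hss', Real.rpow_one]
  have hfac : (a / (s + a)) ^ (1 / s') = ((1 + s / a) ^ (1 / s'))⁻¹ := by
    rw [← Real.inv_rpow (by positivity)]
    congr 1
    field_simp
    ring
  rw [hfac, Real.mul_rpow (by positivity) hT.le]
  set Q := (1 + s / a) ^ (1 / s')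
  have hQ : 0 < Q := Real.rpow_pos_of_pos (by positivity) _
  set U := T ^ (1 / s)
  set V := T ^ (1 / s')
  have hV : 0 < V := Real.rpow_pos_of_pos hT _
  rw [le_div_iff₀ (by positivity)]
  calc 4 / 3 * (1 / (3 * xi s') * Q⁻¹ * (1 - s / a)) * U * (xi s' * (Q * V))
      = 4 / 9 * ((1 - s / a) * (U * V)) := by
        field_simp
        ring
    _ ≤ 4 / 9 * T' := by rw [hpow]; gcongr
    _ ≤ 1 / 2 * T' := by
        have : 0 ≤ T' := gTail_nonneg hg (by omega)
        linarith

end OrthTrig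

theorem mainTheorem2 (s s' : ℝ) (hs : 1 < s) (hss' : 1 / s + 1 / s' = 1)
    (ψ : ℝ → ℝ) (hψ : ψ ∈ OrthTrig.frakM)
    (hsum : Summable fun j : ℕ => ψ ((j + 1 : ℕ) : ℝ) ^ s * ((j + 1 : ℕ) : ℝ) ^ (s - 2))
    (hg : OrthTrig.gFun ψ s' ∈ OrthTrig.frakM₀)
    (hα : s < OrthTrig.alphaInf (OrthTrig.gFun ψ s') 1)
    (n : ℕ) (hn : 1 ≤ n) (β : ℝ) :
    ENNReal.ofReal (4 / 3 * OrthTrig.K₁ ψ s' * OrthTrig.tailSum ψ s n ^ (1 / s)) ≤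
        OrthTrig.bestOrthClass (2 * n) (OrthTrig.LClass (fun k : ℕ => ψ k) β 1)
          (ENNReal.ofReal s) ∧
      OrthTrig.bestOrthClass (2 * n) (OrthTrig.LClass (fun k : ℕ => ψ k) β 1)
          (ENNReal.ofReal s) ≤
        OrthTrig.bestOrthClass (2 * n - 1) (OrthTrig.LClass (fun k : ℕ => ψ k) β 1)
          (ENNReal.ofReal s) ∧
      OrthTrig.bestOrthClass (2 * n - 1) (OrthTrig.LClass (fun k : ℕ => ψ k) β 1)
          (ENNReal.ofReal s) ≤
        ENNReal.ofReal (OrthTrig.K₂ ψ s' * OrthTrig.tailSum ψ s n ^ (1 / s)) := by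
  have hs0 : 0 < s := by linarith
  have hs' : 1 < s' := by
    have h1 : 1 / s < 1 := (div_lt_one hs0).2 hs
    have h2 : 0 < 1 / s' := by linarith
    have h3 : 0 < s' := one_div_pos.1 h2
    have h4 : 0 < 1 / s := by positivity
    exact (div_lt_one h3).1 (by linarith)
  have hS := OrthTrig.summable_gFun hs hss' hψ hsum
  refine ⟨?_, ?_, OrthTrig.bestOrthClass_le hs hss' hψ hS hg hα hn⟩
  · refine le_trans (ENNReal.ofReal_le_ofReal ?_)
      (OrthTrig.le_bestOrthClass hs hs' hss' hψ hS hg hα β hn)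
    rw [OrthTrig.tailSum_eq_gTail hs hss' hψ hn]
    exact OrthTrig.K₁_mul_le hs hs' hss' hS hg hα hn
  · have h := OrthTrig.bestOrthClass_succ_le hψ hs β (2 * n - 1)
    rwa [show 2 * n - 1 + 1 = 2 * n by omega] at h
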